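/- Let $n\ge 1$, let $A\in\mathbb C^{n\times n}$ have all its eigenvalues in the open unit disc, let $B\in\mathbb C^{n\times 1}$ be such that $(A,B)$ is reachable (i.e. $B,AB,\dots,A^{n-1}B$ span $\mathbb C^n$), and put $G(z)=(zI-A)^{-1}B$. Integrals are over the unit circle $\mathbb T$ with respect to the normalized Lebesgue measure $d\vartheta/2\pi$. On the real space $\mathfrak H_n$ of $n\times n$ Hermitian matrices, with inner product $\langle P,Q\rangle=\operatorname{tr}(PQ)$, let $\operatorname{Range}\Gamma\subset\mathfrak H_n$ be the range of $\Gamma:\Phi\mapsto\int G\Phi G^*$ on the real-valued continuous functions on $\mathbb T$, and let $(\operatorname{Range}\Gamma)^\perp$ be its orthogonal complement. Assume that $I\in\operatorname{Range}\Gamma$, and let $\Psi$ be a continuous, strictly positive function on $\mathbb T$. Let $$\mathcal L_\circ=\Big\{\Lambda\in\mathfrak H_n:\ G^*\Lambda G>0\ \text{on}\ \mathbb T,\ \int G\,\frac{\Psi}{G^*\Lambda G}\,G^*=I\Big\},\qquad \mathcal L_{\circ+}=\{\Lambda\in\mathcal L_\circ:\ \Lambda>0\},$$ where $\Lambda>0$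 means that $\Lambda$ is positive definite. Then $\mathcal L_{\circ+}$ is nonempty; $\mathcal L_\circ$ is an affine space, namely $\mathcal L_\circ=\Lambda_\circ+(\operatorname{Range}\Gamma)^\perp$ for every $\Lambda_\circ\in\mathcal L_\circ$; and $\mathcal L_{\circ+}$ is a convex subset of $\mathcal L_\circ$ that is open in the relative topology of $\mathcal L_\circ$. -/

import Mathlib

noncomputable section

namespace SpectralMoment

/-- The real vector space of `n × n` complex Hermitian matrices. -/
abbrev Herm (n : ℕ) : Type := selfAdjoint (Matrix (Fin n) (Fin n) ℂ)

/-- `A` is a stability matrix: all its eigenvalues lie in the open unit disc. -/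
def IsStable {n : ℕ} (A : Matrix (Fin n) (Fin n) ℂ) : Prop :=
  ∀ w ∈ spectrum ℂ A, ‖w‖ < 1

/-- `(A, B)` is a reachable pair: the vectors `B, A B, …, A ^ (n - 1) B` span `ℂ ^ n`. -/
def IsReachable {n : ℕ} (A : Matrix (Fin n) (Fin n) ℂ) (B : Fin n → ℂ) : Prop :=
  Submodule.span ℂ (Set.range fun k : Fin n => (A ^ (k : ℕ)).mulVec B) = ⊤

/-- The transfer function `G(z) = (z I - A)⁻¹ B`, a column vector. -/
def transfer {n : ℕ} (A : Matrix (Fin n) (Fin n) ℂ) (B : Fin n → ℂ) (z : ℂ) : Fin n → ℂ :=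
  ((z • (1 : Matrix (Fin n) (Fin n) ℂ) - A)⁻¹).mulVec B

/-- The function `z ↦ G(z)* Λ G(z)` on the unit circle. For Hermitian `Λ` this number is real,
so taking the real part loses nothing. -/
def quad {n : ℕ} (A : Matrix (Fin n) (Fin n) ℂ) (B : Fin n → ℂ) (Λ : Herm n) (z : Circle) : ℝ :=
  (star (transfer A B z) ⬝ᵥ (Λ : Matrix (Fin n) (Fin n) ℂ).mulVec (transfer A B z)).re

/-- The matrix `∫ G Φ G*`, integrated entrywise over the unit circle with respect to the
normalized Lebesgue measure `dθ / 2π`. -/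
def momentMatrix {n : ℕ} (A : Matrix (Fin n) (Fin n) ℂ) (B : Fin n → ℂ) (Φ : Circle → ℝ) :
    Matrix (Fin n) (Fin n) ℂ :=
  Matrix.of fun i j => (2 * (Real.pi : ℂ))⁻¹ * ∫ θ in (-Real.pi)..Real.pi,
    transfer A B (Circle.exp θ) i * (Φ (Circle.exp θ) : ℂ) * star (transfer A B (Circle.exp θ) j)

theorem momentMatrix_isSelfAdjoint {n : ℕ} (A : Matrix (Fin n) (Fin n) ℂ) (B : Fin n → ℂ)
    (Φ : Circle → ℝ) : IsSelfAdjoint (momentMatrix A B Φ) := by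
  ext i j
  simp only [momentMatrix, Matrix.star_apply, Matrix.of_apply]
  rw [star_mul', Complex.star_def, ← intervalIntegral.intervalIntegral_conj]
  congr 1
  · simpa using Complex.conj_ofNat 2
  · congr 1
    ext θ
    simp
    ring

/-- The operator `Γ : Φ ↦ ∫ G Φ G*` from real continuous functions on the unit circle to
Hermitian matrices. -/
def Gam {n : ℕ} (A : Matrix (Fin n) (Fin n) ℂ) (B : Fin n → ℂ) (Φ : C(Circle, ℝ)) : Herm n :=
  ⟨momentMatrix A B Φ, momentMatrix_isSelfAdjoint A B Φ⟩

/-- The orthogonal complement of a set of Hermitian matrices with respect to the inner product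
`⟨P, Q⟩ = tr (P Q)`. -/
def orthCompl {n : ℕ} (S : Set (Herm n)) : Submodule ℝ (Herm n) where
  carrier := {X | ∀ M ∈ S,
    ((X : Matrix (Fin n) (Fin n) ℂ) * (M : Matrix (Fin n) (Fin n) ℂ)).trace = 0}
  add_mem' := by
    intro X Y hX hY M hM
    simp [add_mul, hX M hM, hY M hM]
  zero_mem' := by
    intro M _
    simp
  smul_mem' := by
    intro c X hX M hM
    simp [hX M hM]

/-- The set of Hermitian `Λ` with `G* Λ G > 0` on the unit circle and
`∫ G (Ψ / G* Λ G) G* = I`. -/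
def solutions {n : ℕ} (A : Matrix (Fin n) (Fin n) ℂ) (B : Fin n → ℂ) (Ψ : C(Circle, ℝ)) :
    Set (Herm n) :=
  {Λ | (∀ z : Circle, 0 < quad A B Λ z) ∧ momentMatrix A B (fun z => Ψ z / quad A B Λ z) = 1}

open scoped ComplexOrder in
/-- The set of positive definite elements of `solutions A B Ψ`. -/
def posSolutions {n : ℕ} (A : Matrix (Fin n) (Fin n) ℂ) (B : Fin n → ℂ) (Ψ : C(Circle, ℝ)) :
    Set (Herm n) :=
  {Λ | Λ ∈ solutions A B Ψ ∧ (Λ : Matrix (Fin n) (Fin n) ℂ).PosDef}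

end SpectralMoment

end

noncomputable section

namespace SpectralMoment

open Polynomial Matrix Filter Topology

/-! ### Fejér–Riesz factorization by induction on the degree -/

section

/-! Everything rests on the duality `tr (X Γ(Φ)) = ∫ Φ · G*XG` (`trace_mul_momentMatrix`). It
identifies `(Range Γ)^⊥` with the `X` for which `G*XG` vanishes on the circle. If `Λ` and `M` both
solve the moment equation, pairing the difference of their equations with `Λ - M` gives `∫ Ψ (a -
b)² / (a b) = 0` for `a = G*ΛG`, `b = G*MG`. Hence `a = b`, and the solution set is a coset of
`(Range Γ)^⊥`. Convexity and relative openness then come from the positive definite cone.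

Existence is variational: maximize `∫ Ψ log G*ΛG` over `Λ ≥ δI` with trace `n`, then let `δ → 0`.
First-order optimality (`exists_kkt`) tested at `I` bounds `∫ Ψ G*G / G*ΛG` uniformly in `δ`. The
limit `G*ΛG` therefore has no zero on the circle: such a zero would be double and the integral would
blow up (`exists_optimal`).

The limit may be singular as a matrix. Fejér–Riesz with reachability replaces it by a positive
definite matrix with the same `G*ΛG` (`exists_posDef_quad_eq`), and `I ∈ Range Γ` ensures that the
trace does not change. Optimality at an interior point of the cone makes `∫ G (Ψ / G*ΛG) G*`
orthogonal to all traceless matrices, hence a multiple `l I`; rescaling `Λ` by `l > 0` solves the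
equation. -/

theorem infinite_unit_circle : {z : ℂ | ‖z‖ = 1}.Infinite := by
  have h : Set.InjOn (fun t : ℝ => ((Circle.exp t : Circle) : ℂ)) (Set.Icc 0 1) := fun a ha b hb hab =>
    Circle.exp_injOn_Icc (by linarith [Real.pi_gt_three]) ha hb (Subtype.ext hab)
  refine Set.Infinite.mono ?_ ((Set.Icc_infinite (zero_lt_one (α := ℝ))).image h)
  rintro _ ⟨t, _, rfl⟩
  exact Circle.norm_coe _

/-- A polynomial `P` with `z ^ (-m) P(z)` real on the unit circle is self-inversive. -/
theorem eval_eq_of_real_on_circle {m : ℕ} {P : ℂ[X]} (hdeg : P.natDegree ≤ 2 * m) {r : ℂ → ℝ}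
    (hP : ∀ z : ℂ, ‖z‖ = 1 → P.eval z = z ^ m * (r z : ℂ)) :
    (P.map (starRingEnd ℂ)).reflect (2 * m) = P := by
  refine Polynomial.eq_of_infinite_eval_eq _ _ (infinite_unit_circle.mono fun z hz => ?_)
  have hz : ‖z‖ = 1 := hz
  have hz0 : z ≠ 0 := by
    rintro rfl
    simp at hz
  have hc : (starRingEnd ℂ) z = z⁻¹ := by
    rw [Complex.inv_def, Complex.normSq_eq_norm_sq, hz]
    simp
  have hd : (P.map (starRingEnd ℂ)).natDegree ≤ 2 * m := (natDegree_map_le).trans hdeg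
  let _ : Invertible z⁻¹ := invertibleOfNonzero (inv_ne_zero hz0)
  have h := eval₂_reflect_mul_pow (RingHom.id ℂ) z⁻¹ (2 * m) (P.map (starRingEnd ℂ)) hd
  have h3 : (P.map (starRingEnd ℂ)).eval z⁻¹ = (starRingEnd ℂ) (P.eval z) := by
    rw [← hc, eval_map, eval₂_hom]
  simp only [invOf_eq_inv, inv_inv] at h
  rw [← eval, ← eval, h3, hP z hz, map_mul, map_pow, hc, Complex.conj_ofReal] at h
  show eval z _ = eval z P
  rw [hP z hz]
  apply mul_right_cancel₀ (pow_ne_zero (2 * m) (inv_ne_zero hz0))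
  have e : z ^ m * z⁻¹ ^ m = 1 := by rw [← mul_pow, mul_inv_cancel₀ hz0, one_pow]
  rw [h, two_mul, pow_add]
  linear_combination (-(z⁻¹ ^ m * (r z : ℂ))) * e

/-- **Fejér–Riesz theorem** for strictly positive trigonometric polynomials. -/
theorem exists_norm_sq_eval_eq (m : ℕ) : ∀ (P : ℂ[X]) (r : ℂ → ℝ), P.natDegree ≤ 2 * m →
    (∀ z : ℂ, ‖z‖ = 1 → 0 < r z) → (∀ z : ℂ, ‖z‖ = 1 → P.eval z = z ^ m * (r z : ℂ)) →
    ∃ q : ℂ[X], q.natDegree ≤ m ∧ ∀ z : ℂ, ‖z‖ = 1 → ‖q.eval z‖ ^ 2 = r z := by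
  induction m with
  | zero =>
    intro P r hdeg hr hP
    obtain ⟨c, rfl⟩ := natDegree_eq_zero.mp (Nat.le_zero.mp hdeg)
    simp only [eval_C, pow_zero, one_mul] at hP
    refine ⟨C (Real.sqrt (r 1) : ℂ), by simp, fun z hz => ?_⟩
    have h1 : r z = r 1 := by
      exact_mod_cast (hP z hz).symm.trans (hP 1 (by simp))
    rw [eval_C, Complex.norm_real, Real.norm_eq_abs, sq_abs, Real.sq_sqrt (hr 1 (by simp)).le, h1]
  | succ m ih =>
    intro P r hdeg hr hP
    have hrefl := eval_eq_of_real_on_circle hdeg hP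
    have hcoeff : P.coeff (2 * (m + 1)) = (starRingEnd ℂ) (P.coeff 0) := by
      conv_lhs => rw [← hrefl]
      rw [coeff_reflect, revAt_le le_rfl, Nat.sub_self, coeff_map]
    -- If the constant coefficient vanishes, so does the one of index `2(m+1)` by symmetry, so
    -- dividing by `X` lowers the degree bound by two and keeps `r`.
    by_cases h0 : P.coeff 0 = 0
    · have hX : X * P.divX = P := by
        have := P.X_mul_divX_add
        rwa [h0, C_0, add_zero] at this
      have hlt : P.natDegree ≤ 2 * m + 1 := by
        by_contra hlt
        have h2 : P.natDegree = 2 * (m + 1) := by omega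
        have : P.leadingCoeff = 0 := by
          rw [leadingCoeff, h2, hcoeff, h0, map_zero]
        rw [leadingCoeff_eq_zero] at this
        simp [this] at h2
      obtain ⟨q, hq, hqr⟩ := ih P.divX r (by rw [natDegree_divX_eq_natDegree_tsub_one]; omega) hr
        (fun z hz => by
          have hz0 : z ≠ 0 := by
            rintro rfl
            simp at hz
          have h := hP z hz
          rw [← hX, eval_mul, eval_X, pow_succ', mul_assoc] at h
          exact mul_left_cancel₀ hz0 h)
      exact ⟨q, by omega, hqr⟩
    · have hd : P.degree ≠ 0 := by
        intro hd
        have h2 : P.coeff (2 * (m + 1)) = 0 := coeff_eq_zero_of_natDegree_lt (by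
          rw [natDegree_eq_zero_iff_degree_le_zero.mpr hd.le]; omega)
        rw [hcoeff] at h2
        exact h0 (by simpa using h2)
      obtain ⟨a, ha⟩ := IsAlgClosed.exists_root P hd
      have ha0 : a ≠ 0 := by
        rintro rfl
        exact h0 (by rwa [coeff_zero_eq_eval_zero])
      have ha1 : ‖a‖ ≠ 1 := by
        intro h1
        have h := hP a h1
        rw [ha] at h
        have h2 := (hr a h1).ne'
        have h3 : a ^ (m + 1) * (r a : ℂ) ≠ 0 :=
          mul_ne_zero (pow_ne_zero _ ha0) (by exact_mod_cast h2)
        exact h3 h.symm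
      set a' : ℂ := (starRingEnd ℂ) a with ha'
      have ha'0 : a' ≠ 0 := by simpa [ha'] using ha0
      -- Self-inversiveness reflects the root `a` across the circle. As `‖a‖ ≠ 1`, the reflected
      -- root is distinct and both factors split off.
      have hb : P.eval a'⁻¹ = 0 := by
        let _ : Invertible a' := invertibleOfNonzero ha'0
        have h := eval₂_reflect_mul_pow (RingHom.id ℂ) a' (2 * (m + 1))
          (P.map (starRingEnd ℂ)) ((natDegree_map_le).trans hdeg)
        rw [hrefl, invOf_eq_inv, ← eval, ← eval, ha', eval_map, eval₂_hom, ha, map_zero] at h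
        exact (mul_eq_zero.mp h).resolve_right (pow_ne_zero _ ha'0)
      obtain ⟨P1, hP1⟩ := dvd_iff_isRoot.mpr ha
      have hab : a'⁻¹ - a ≠ 0 := by
        intro h
        have h1 : a * a' = 1 := by
          rw [← sub_eq_zero.mp h]
          exact inv_mul_cancel₀ ha'0
        rw [ha', Complex.mul_conj, Complex.normSq_eq_norm_sq] at h1
        have h2 : ‖a‖ ^ 2 = 1 := by exact_mod_cast h1
        exact ha1 ((pow_eq_one_iff_of_nonneg (norm_nonneg a) two_ne_zero).mp h2)
      have hb1 : P1.eval a'⁻¹ = 0 := by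
        rw [hP1, eval_mul, eval_sub, eval_X, eval_C] at hb
        exact (mul_eq_zero.mp hb).resolve_left hab
      obtain ⟨P2, hP2⟩ := dvd_iff_isRoot.mpr hb1
      have hP20 : P2 ≠ 0 := by
        rintro rfl
        rw [hP1, hP2] at h0
        simp at h0
      have hdeg2 : P2.natDegree ≤ 2 * m := by
        have h : P.natDegree = 1 + (1 + P2.natDegree) := by
          rw [hP1, hP2, natDegree_mul (X_sub_C_ne_zero _) (mul_ne_zero (X_sub_C_ne_zero _) hP20),
            natDegree_mul (X_sub_C_ne_zero _) hP20, natDegree_X_sub_C, natDegree_X_sub_C]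
        omega
      have hza : ∀ z : ℂ, ‖z‖ = 1 → 0 < ‖z - a‖ := fun z hz => by
        rw [norm_pos_iff, sub_ne_zero]
        rintro rfl
        exact ha1 hz
      -- On the circle `(z - a)(z - a'⁻¹) = -a'⁻¹ z |z - a|²`, which dictates both the constant and
      -- the new `r`.
      obtain ⟨q, hq, hqr⟩ := ih (C (-a'⁻¹) * P2) (fun z => r z / ‖z - a‖ ^ 2)
        ((natDegree_C_mul_le _ _).trans hdeg2)
        (fun z hz => div_pos (hr z hz) (pow_pos (hza z hz) 2))
        (fun z hz => by
          have hz0 : z ≠ 0 := by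
            rintro rfl
            simp at hz
          have hne : ((‖z - a‖ : ℝ) : ℂ) ^ 2 ≠ 0 := by
            exact_mod_cast (pow_pos (hza z hz) 2).ne'
          have hc : (starRingEnd ℂ) z = z⁻¹ := by
            rw [Complex.inv_def, Complex.normSq_eq_norm_sq, hz]
            simp
          have hn : ((‖z - a‖ : ℝ) : ℂ) ^ 2 = (z - a) * (z⁻¹ - a') := by
            rw [← Complex.ofReal_pow, ← Complex.normSq_eq_norm_sq, ← Complex.mul_conj, map_sub, hc]
          have h := hP z hz
          rw [hP1, hP2] at h
          simp only [eval_mul, eval_sub, eval_X, eval_C] at h ⊢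
          push_cast
          rw [← mul_div_assoc, eq_div_iff hne, hn]
          apply mul_left_cancel₀ hz0
          rw [← mul_assoc z (z ^ m), ← pow_succ', ← h]
          field_simp
          ring)
      refine ⟨(X - C a) * q, ?_, fun z hz => ?_⟩
      · refine natDegree_mul_le.trans ?_
        rw [natDegree_X_sub_C]
        omega
      · rw [eval_mul, norm_mul, mul_pow, hqr z hz, eval_sub, eval_X, eval_C]
        exact mul_div_cancel₀ _ (pow_pos (hza z hz) 2).ne'

end

/-! ### The numerator polynomial of the transfer function and reachability -/

section

variable {n : ℕ} (A : Matrix (Fin n) (Fin n) ℂ) (B : Fin n → ℂ)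

/-- The `i`-th coefficient of the polynomial vector `adj(z I - A) B`. -/
def numerCoeff (i : ℕ) : Fin n → ℂ :=
  ∑ j ∈ Finset.range (n - i), A.charpoly.coeff (i + 1 + j) • (A ^ j).mulVec B

/-- The polynomial vector `adj(z I - A) B`. -/
def numer (z : ℂ) : Fin n → ℂ := ∑ i ∈ Finset.range n, z ^ i • numerCoeff A B i

theorem numerCoeff_self : numerCoeff A B n = 0 := by simp [numerCoeff]

/-- Horner's recursion, descending from the zero value at index `n`; Cayley–Hamilton closes it at
index `0` in `mulVec_numerCoeff_zero`. -/
theorem numerCoeff_eq {i : ℕ} (hi : i < n) :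
    numerCoeff A B i = A.charpoly.coeff (i + 1) • B + A.mulVec (numerCoeff A B (i + 1)) := by
  have h : n - i = (n - (i + 1)) + 1 := by omega
  rw [numerCoeff, h, Finset.sum_range_succ', add_comm, numerCoeff, Matrix.mulVec_sum]
  congr 1
  · simp
  · refine Finset.sum_congr rfl fun j _ => ?_
    rw [Matrix.mulVec_smul, Matrix.mulVec_mulVec, ← pow_succ', add_assoc _ 1 j,
      add_comm 1 j]

theorem charpoly_coeff_self : A.charpoly.coeff n = 1 := by
  have h := A.charpoly_monic
  rwa [Monic, leadingCoeff, charpoly_natDegree_eq_dim, Fintype.card_fin] at h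

theorem mulVec_numerCoeff_zero :
    A.mulVec (numerCoeff A B 0) = -(A.charpoly.coeff 0 • B) := by
  have h : (aeval A A.charpoly).mulVec B = 0 := by
    rw [aeval_self_charpoly, Matrix.zero_mulVec]
  rw [aeval_eq_sum_range, charpoly_natDegree_eq_dim, Fintype.card_fin, Finset.sum_range_succ',
    Matrix.add_mulVec, Matrix.sum_mulVec] at h
  rw [numerCoeff, Matrix.mulVec_sum, eq_neg_iff_add_eq_zero, ← h, Nat.sub_zero]
  congr 1
  · refine Finset.sum_congr rfl fun j _ => ?_
    rw [Matrix.mulVec_smul, Matrix.mulVec_mulVec, ← pow_succ', Matrix.smul_mulVec, zero_add,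
      add_comm]
  · rw [pow_zero, Matrix.smul_mulVec, Matrix.one_mulVec]

theorem sub_mulVec_numer (z : ℂ) :
    (z • (1 : Matrix (Fin n) (Fin n) ℂ) - A).mulVec (numer A B z) = A.charpoly.eval z • B := by
  have h1 : z • numer A B z = ∑ i ∈ Finset.range n, (A.charpoly.coeff (i + 1) * z ^ (i + 1)) • B
      + ∑ i ∈ Finset.range n, z ^ (i + 1) • A.mulVec (numerCoeff A B (i + 1)) := by
    rw [numer, Finset.smul_sum, ← Finset.sum_add_distrib]
    refine Finset.sum_congr rfl fun i hi => ?_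
    rw [numerCoeff_eq A B (Finset.mem_range.mp hi), smul_smul, ← pow_succ', smul_add, smul_smul,
      mul_comm (z ^ (i + 1))]
  have h2 : A.mulVec (numer A B z) =
      ∑ i ∈ Finset.range n, z ^ i • A.mulVec (numerCoeff A B i) := by
    rw [numer, Matrix.mulVec_sum]
    exact Finset.sum_congr rfl fun i _ => Matrix.mulVec_smul _ _ _
  -- The recursion makes the difference telescope; the boundary term at `0` supplies the constant
  -- coefficient of the characteristic polynomial.
  have h3 := Finset.sum_range_sub (fun i => z ^ i • A.mulVec (numerCoeff A B i)) n
  rw [Finset.sum_sub_distrib, numerCoeff_self, mulVec_numerCoeff_zero] at h3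
  rw [Matrix.sub_mulVec, Matrix.smul_mulVec, Matrix.one_mulVec, h1, h2, add_sub_assoc, h3,
    eval_eq_sum_range, charpoly_natDegree_eq_dim, Fintype.card_fin, Finset.sum_range_succ',
    add_smul, Finset.sum_smul]
  simp

variable {A B}

theorem charpoly_eval_ne_zero (hA : IsStable A) {z : ℂ} (hz : ‖z‖ = 1) :
    A.charpoly.eval z ≠ 0 := fun h =>
  (hA z (mem_spectrum_iff_isRoot_charpoly.mpr h)).ne hz

theorem isUnit_smul_one_sub (hA : IsStable A) {z : ℂ} (hz : ‖z‖ = 1) :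
    IsUnit (z • (1 : Matrix (Fin n) (Fin n) ℂ) - A).det := by
  have h : z ∉ spectrum ℂ A := fun h => (hA z h).ne hz
  rw [spectrum.notMem_iff, Algebra.algebraMap_eq_smul_one] at h
  exact (Matrix.isUnit_iff_isUnit_det _).mp h

theorem transfer_eq_numer (hA : IsStable A) {z : ℂ} (hz : ‖z‖ = 1) :
    transfer A B z = (A.charpoly.eval z)⁻¹ • numer A B z := by
  have h := congrArg ((z • (1 : Matrix (Fin n) (Fin n) ℂ) - A)⁻¹).mulVec (sub_mulVec_numer A B z)
  rw [Matrix.mulVec_mulVec, Matrix.nonsing_inv_mul _ (isUnit_smul_one_sub hA hz),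
    Matrix.one_mulVec, Matrix.mulVec_smul] at h
  rw [h, smul_smul, inv_mul_cancel₀ (charpoly_eval_ne_zero hA hz), one_smul, transfer]

theorem reachable_ne_zero (hn : 0 < n) (hAB : IsReachable A B) : B ≠ 0 := by
  rintro rfl
  have : Nonempty (Fin n) := ⟨⟨0, hn⟩⟩
  simp only [IsReachable, Matrix.mulVec_zero, Set.range_const, Submodule.span_zero_singleton] at hAB
  exact bot_ne_top hAB

theorem transfer_ne_zero (hn : 0 < n) (hA : IsStable A) (hAB : IsReachable A B) {z : ℂ}
    (hz : ‖z‖ = 1) : transfer A B z ≠ 0 := by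
  intro h
  have h2 := congrArg (z • (1 : Matrix (Fin n) (Fin n) ℂ) - A).mulVec h
  rw [transfer, Matrix.mulVec_mulVec, Matrix.mul_nonsing_inv _ (isUnit_smul_one_sub hA hz),
    Matrix.one_mulVec, Matrix.mulVec_zero] at h2
  exact reachable_ne_zero hn hAB h2

/-- The span contains `B`, the coefficient of index `n - 1`, and the recursion makes it
`A`-invariant, so it contains every `A ^ k B`. -/
theorem span_numerCoeff (hn : 0 < n) (hAB : IsReachable A B) :
    Submodule.span ℂ (Set.range fun i : Fin n => numerCoeff A B i) = ⊤ := by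
  set S := Submodule.span ℂ (Set.range fun i : Fin n => numerCoeff A B i) with hS
  have hmem : ∀ i, i < n → numerCoeff A B i ∈ S := fun i hi =>
    Submodule.subset_span ⟨⟨i, hi⟩, rfl⟩
  have hB : B ∈ S := by
    have h := numerCoeff_eq A B (i := n - 1) (by omega)
    rw [Nat.sub_add_cancel hn, numerCoeff_self, charpoly_coeff_self, one_smul, Matrix.mulVec_zero,
      add_zero] at h
    rw [← h]
    exact hmem _ (by omega)
  have hinv : S ≤ S.comap A.mulVecLin := by
    rw [hS, Submodule.span_le, ← hS]
    rintro _ ⟨⟨i, hi⟩, rfl⟩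
    show A.mulVec (numerCoeff A B i) ∈ S
    cases i with
    | zero =>
      rw [mulVec_numerCoeff_zero]
      exact S.neg_mem (S.smul_mem _ hB)
    | succ i =>
      have h := numerCoeff_eq A B (i := i) (by omega)
      rw [← sub_eq_iff_eq_add'] at h
      rw [← h]
      exact S.sub_mem (hmem i (by omega)) (S.smul_mem _ hB)
  have hpow : ∀ k : ℕ, (A ^ k).mulVec B ∈ S := by
    intro k
    induction k with
    | zero => simpa using hB
    | succ k ih =>
      rw [pow_succ', ← Matrix.mulVec_mulVec]
      exact hinv ih
  rw [eq_top_iff, ← show _ = ⊤ from hAB, Submodule.span_le]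
  rintro _ ⟨k, rfl⟩
  exact hpow k

/-- Being `n` spanning vectors, the coefficients form a basis. Thus every polynomial of degree below
`n` is a linear functional of `adj(zI - A)B`. -/
theorem exists_dotProduct_numerCoeff (hn : 0 < n) (hAB : IsReachable A B) (q : Fin n → ℂ) :
    ∃ c : Fin n → ℂ, ∀ i : Fin n, c ⬝ᵥ numerCoeff A B i = q i := by
  have hspan := span_numerCoeff hn hAB
  have hli := linearIndependent_of_top_le_span_of_card_eq_finrank hspan.ge (by simp)
  let b := Module.Basis.mk hli hspan.ge
  let f : (Fin n → ℂ) →ₗ[ℂ] ℂ := b.constr ℂ q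
  refine ⟨fun j => f (Pi.single j 1), fun i => ?_⟩
  have h : f (numerCoeff A B i) = q i := by
    have h2 := b.constr_basis ℂ q i
    rwa [Module.Basis.mk_apply] at h2
  rw [← h, LinearMap.pi_apply_eq_sum_univ f]
  simp only [dotProduct, smul_eq_mul]
  refine Finset.sum_congr rfl fun j _ => ?_
  rw [mul_comm]
  congr 2
  ext k
  simp [Pi.single_apply, eq_comm]

theorem continuous_transfer (hA : IsStable A) :
    Continuous fun z : Circle => transfer A B z := by
  have h : (fun z : Circle => transfer A B z) =
      fun z : Circle => (A.charpoly.eval (z : ℂ))⁻¹ • numer A B z :=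
    funext fun z => transfer_eq_numer hA (Circle.norm_coe z)
  rw [h]
  refine Continuous.smul (Continuous.inv₀ ?_ fun z => charpoly_eval_ne_zero hA (Circle.norm_coe z)) ?_
  · exact A.charpoly.continuous.comp continuous_subtype_val
  · unfold numer
    exact continuous_finsetSum _ fun i _ => (continuous_subtype_val.pow i).smul continuous_const

theorem differentiableAt_transfer_exp (hA : IsStable A) (t : ℝ) :
    DifferentiableAt ℝ (fun θ : ℝ => transfer A B (Circle.exp θ)) t := by
  have h : (fun θ : ℝ => transfer A B (Circle.exp θ)) =
      fun θ : ℝ => (A.charpoly.eval (Complex.exp (θ * Complex.I)))⁻¹ •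
        numer A B (Complex.exp (θ * Complex.I)) :=
    funext fun θ => by
      rw [transfer_eq_numer hA (Circle.norm_coe _), Circle.coe_exp]
  rw [h]
  have h1 : DifferentiableAt ℝ (fun θ : ℝ => A.charpoly.eval (Complex.exp (θ * Complex.I))) t := by
    simp_rw [eval_eq_sum_range]
    fun_prop
  have h2 : DifferentiableAt ℝ (fun θ : ℝ => numer A B (Complex.exp (θ * Complex.I))) t := by
    unfold numer
    fun_prop
  exact (h1.fun_inv (charpoly_eval_ne_zero hA (by simp [Complex.norm_exp]))).fun_smul h2

end

/-! ### Circle means, the trace pairing, and positive definite representatives -/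

section

/-- The mean of a function on the unit circle with respect to `dθ / 2π`. -/
def circMean (f : Circle → ℝ) : ℝ := (2 * Real.pi)⁻¹ * ∫ θ in (-Real.pi)..Real.pi, f (Circle.exp θ)

theorem intervalIntegrable_comp_exp {f : Circle → ℝ} (hf : Continuous f) (a b : ℝ) :
    IntervalIntegrable (fun θ => f (Circle.exp θ)) MeasureTheory.volume a b :=
  (hf.comp Circle.exp.continuous).intervalIntegrable _ _

theorem circMean_add {f g : Circle → ℝ} (hf : Continuous f) (hg : Continuous g) :
    circMean (fun z => f z + g z) = circMean f + circMean g := by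
  rw [circMean, intervalIntegral.integral_add (intervalIntegrable_comp_exp hf _ _)
    (intervalIntegrable_comp_exp hg _ _), mul_add, circMean, circMean]

theorem circMean_sub {f g : Circle → ℝ} (hf : Continuous f) (hg : Continuous g) :
    circMean (fun z => f z - g z) = circMean f - circMean g := by
  rw [circMean, intervalIntegral.integral_sub (intervalIntegrable_comp_exp hf _ _)
    (intervalIntegrable_comp_exp hg _ _), mul_sub, circMean, circMean]

theorem circMean_mono {f g : Circle → ℝ} (hf : Continuous f) (hg : Continuous g)
    (h : ∀ z, f z ≤ g z) : circMean f ≤ circMean g :=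
  mul_le_mul_of_nonneg_left (intervalIntegral.integral_mono (by linarith [Real.pi_pos])
    (intervalIntegrable_comp_exp hf _ _) (intervalIntegrable_comp_exp hg _ _) fun _ => h _)
    (by positivity)

theorem circMean_pos {f : Circle → ℝ} (hf : Continuous f) (h : ∀ z, 0 ≤ f z) {z : Circle}
    (hz : 0 < f z) : 0 < circMean f := by
  refine mul_pos (by positivity) (intervalIntegral.integral_pos (by linarith [Real.pi_pos])
    (hf.comp Circle.exp.continuous).continuousOn (fun _ _ => h _)
    ⟨(z : ℂ).arg, ⟨(Complex.neg_pi_lt_arg _).le, Complex.arg_le_pi _⟩, ?_⟩)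
  simpa only [Function.comp_def, Circle.exp_arg] using hz

theorem eq_zero_of_circMean_eq_zero {f : Circle → ℝ} (hf : Continuous f) (h : ∀ z, 0 ≤ f z)
    (h0 : circMean f = 0) (z : Circle) : f z = 0 := by
  by_contra hz
  exact (circMean_pos hf h (lt_of_le_of_ne (h z) (Ne.symm hz))).ne' h0

variable {n : ℕ} {A : Matrix (Fin n) (Fin n) ℂ} {B : Fin n → ℂ}

theorem im_star_dotProduct_mulVec (X : Herm n) (x : Fin n → ℂ) :
    (star x ⬝ᵥ (X : Matrix (Fin n) (Fin n) ℂ).mulVec x).im = 0 :=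
  Matrix.IsHermitian.im_star_dotProduct_mulVec_self
    (show (X : Matrix (Fin n) (Fin n) ℂ).IsHermitian from X.2) x

theorem ofReal_quad (X : Herm n) (z : Circle) :
    (quad A B X z : ℂ) =
      star (transfer A B z) ⬝ᵥ (X : Matrix (Fin n) (Fin n) ℂ).mulVec (transfer A B z) :=
  Complex.ext (by simp [quad]) (by rw [Complex.ofReal_im, im_star_dotProduct_mulVec])

theorem quad_add (X Y : Herm n) (z : Circle) :
    quad A B (X + Y) z = quad A B X z + quad A B Y z := by
  simp [quad, Matrix.add_mulVec]

theorem quad_sub (X Y : Herm n) (z : Circle) :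
    quad A B (X - Y) z = quad A B X z - quad A B Y z := by
  simp [quad, Matrix.sub_mulVec]

theorem quad_smul (c : ℝ) (X : Herm n) (z : Circle) :
    quad A B (c • X) z = c * quad A B X z := by
  simp [quad, Matrix.smul_mulVec]

theorem continuous_quad (hA : IsStable A) (X : Herm n) : Continuous (quad A B X) := by
  have h := continuous_transfer (B := B) hA
  exact Complex.continuous_re.comp (h.star.dotProduct (continuous_const.matrix_mulVec h))

theorem quad_one_pos (hn : 0 < n) (hA : IsStable A) (hAB : IsReachable A B) (z : Circle) :
    0 < quad A B 1 z := by
  open scoped ComplexOrder in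
  have h := (Matrix.PosDef.one (n := Fin n) (R := ℂ)).re_dotProduct_pos
    (transfer_ne_zero hn hA hAB (Circle.norm_coe z))
  exact h

theorem trace_mul_momentMatrix (hA : IsStable A) (X : Herm n) {Φ : Circle → ℝ}
    (hΦ : Continuous Φ) :
    ((X : Matrix (Fin n) (Fin n) ℂ) * momentMatrix A B Φ).trace =
      (circMean fun z => Φ z * quad A B X z : ℝ) := by
  have hG : Continuous fun θ : ℝ => transfer A B (Circle.exp θ) :=
    (continuous_transfer hA).comp Circle.exp.continuous
  have hGi : ∀ i, Continuous fun θ : ℝ => transfer A B (Circle.exp θ) i := fun i =>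
    (continuous_apply i).comp hG
  have hΦ' : Continuous fun θ : ℝ => (Φ (Circle.exp θ) : ℂ) :=
    Complex.continuous_ofReal.comp (hΦ.comp Circle.exp.continuous)
  rw [circMean, Complex.ofReal_mul, ← intervalIntegral.integral_ofReal]
  have h : ∀ θ : ℝ, ((Φ (Circle.exp θ) * quad A B X (Circle.exp θ) : ℝ) : ℂ) =
      ∑ i, ∑ j, (X : Matrix (Fin n) (Fin n) ℂ) i j * (transfer A B (Circle.exp θ) j *
        (Φ (Circle.exp θ) : ℂ) * star (transfer A B (Circle.exp θ) i)) := by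
    intro θ
    rw [Complex.ofReal_mul, ofReal_quad]
    simp only [dotProduct, Matrix.mulVec, Finset.mul_sum, Pi.star_apply]
    refine Finset.sum_congr rfl fun i _ => Finset.sum_congr rfl fun j _ => ?_
    ring
  simp_rw [h]
  have hint : ∀ i j, Continuous fun θ : ℝ => (X : Matrix (Fin n) (Fin n) ℂ) i j *
      (transfer A B (Circle.exp θ) j * (Φ (Circle.exp θ) : ℂ) *
        star (transfer A B (Circle.exp θ) i)) := fun i j =>
    continuous_const.mul (((hGi j).mul hΦ').mul (hGi i).star)
  rw [intervalIntegral.integral_finsetSum fun i _ =>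
    (continuous_finsetSum _ fun j _ => hint i j).intervalIntegrable _ _, Finset.mul_sum]
  simp only [Matrix.trace, Matrix.diag_apply, Matrix.mul_apply]
  refine Finset.sum_congr rfl fun i _ => ?_
  rw [intervalIntegral.integral_finsetSum fun j _ => (hint i j).intervalIntegrable _ _,
    Finset.mul_sum]
  refine Finset.sum_congr rfl fun j _ => ?_
  rw [intervalIntegral.integral_const_mul, momentMatrix, Matrix.of_apply]
  push_cast
  ring

theorem trace_mul_Gam (hA : IsStable A) (X : Herm n) (Φ : C(Circle, ℝ)) :
    ((X : Matrix (Fin n) (Fin n) ℂ) * (Gam A B Φ : Matrix (Fin n) (Fin n) ℂ)).trace =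
      (circMean fun z => Φ z * quad A B X z : ℝ) :=
  trace_mul_momentMatrix hA X Φ.continuous

theorem mem_orthCompl_iff (hA : IsStable A) (X : Herm n) :
    X ∈ orthCompl (Set.range (Gam A B)) ↔ ∀ z, quad A B X z = 0 := by
  have hq := continuous_quad (B := B) hA X
  constructor
  · intro h z
    -- Testing against `Φ = G*XG` itself gives `∫ (G*XG)² = 0`.
    have h1 := h (Gam A B ⟨quad A B X, hq⟩) (Set.mem_range_self _)
    rw [trace_mul_Gam hA, Complex.ofReal_eq_zero] at h1
    have h2 := eq_zero_of_circMean_eq_zero (hq.mul hq) (fun z => mul_self_nonneg _) h1 z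
    exact mul_self_eq_zero.mp h2
  · rintro h _ ⟨Φ, rfl⟩
    rw [trace_mul_Gam hA]
    simp [h, circMean]

/-- If `I` is in the range of `Γ`, then the trace of `X` depends on `G* X G` only. -/
theorem trace_eq_of_quad_eq (hA : IsStable A) (hI : (1 : Herm n) ∈ Set.range (Gam A B))
    {X Y : Herm n} (h : ∀ z, quad A B X z = quad A B Y z) :
    (X : Matrix (Fin n) (Fin n) ℂ).trace = (Y : Matrix (Fin n) (Fin n) ℂ).trace := by
  have h1 : X - Y ∈ orthCompl (Set.range (Gam A B)) :=
    (mem_orthCompl_iff hA _).mpr fun z => by rw [quad_sub, h, sub_self]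
  have h2 := h1 1 hI
  simpa [sub_eq_zero] using h2

theorem continuous_div_quad (hA : IsStable A) (Ψ : C(Circle, ℝ)) {X : Herm n}
    (hX : ∀ z, 0 < quad A B X z) : Continuous fun z => Ψ z / quad A B X z :=
  Ψ.continuous.div (continuous_quad hA X) fun z => (hX z).ne'

theorem momentMatrix_smul (c : ℝ) (Φ : Circle → ℝ) :
    momentMatrix A B (fun z => c * Φ z) = (c : ℂ) • momentMatrix A B Φ := by
  ext i j
  simp only [momentMatrix, Matrix.of_apply, Matrix.smul_apply, smul_eq_mul]
  rw [mul_left_comm, ← intervalIntegral.integral_const_mul (c : ℂ)]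
  congr 2
  funext θ
  push_cast
  ring

open scoped ComplexOrder in
-- After clearing `|χ|²`, with `χ` the characteristic polynomial, `G*XG` is a positive trigonometric
-- polynomial of degree at most `n - 1`. Its Fejér–Riesz factor `q` has degree below `n`, so it is
-- `c ⬝ᵥ numer`, and the rank-one matrix built from `c` has the required form.
theorem exists_vecMulVec_quad_eq (hn : 0 < n) (hA : IsStable A) (hAB : IsReachable A B)
    {X : Herm n} (hX : ∀ z, 0 < quad A B X z) :
    ∃ Y : Herm n, (Y : Matrix (Fin n) (Fin n) ℂ).PosSemidef ∧
      ∀ z, quad A B Y z = quad A B X z := by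
  set w := numerCoeff A B with hw
  let r : ℂ → ℝ := fun z =>
    (star (numer A B z) ⬝ᵥ (X : Matrix (Fin n) (Fin n) ℂ).mulVec (numer A B z)).re
  have hrX : ∀ z : Circle, quad A B X z = ‖A.charpoly.eval (z : ℂ)‖⁻¹ ^ 2 * r z := by
    intro z
    have h : star (A.charpoly.eval (z : ℂ))⁻¹ * (A.charpoly.eval (z : ℂ))⁻¹ =
        ((‖A.charpoly.eval (z : ℂ)‖⁻¹ ^ 2 : ℝ) : ℂ) := by
      rw [← norm_inv, ← Complex.normSq_eq_norm_sq, ← Complex.mul_conj, mul_comm]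
      rfl
    rw [quad, transfer_eq_numer hA (Circle.norm_coe z), star_smul, Matrix.mulVec_smul,
      smul_dotProduct, dotProduct_smul, smul_smul, h, smul_eq_mul, Complex.re_ofReal_mul]
  have hchi : ∀ z : Circle, 0 < ‖A.charpoly.eval (z : ℂ)‖ := fun z =>
    norm_pos_iff.mpr (charpoly_eval_ne_zero hA (Circle.norm_coe z))
  have hr : ∀ z : ℂ, ‖z‖ = 1 → 0 < r z := by
    intro z hz
    obtain ⟨u, rfl⟩ : ∃ u : Circle, (u : ℂ) = z := ⟨⟨z, mem_sphere_zero_iff_norm.mpr hz⟩, rfl⟩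
    have h := hX u
    rw [hrX] at h
    exact (pos_iff_pos_of_mul_pos h).mp (pow_pos (inv_pos.mpr (hchi u)) 2)
  -- The exponent comes from `z ^ (n - 1) * conj z ^ i * z ^ j` on the circle.
  let P : ℂ[X] := ∑ i ∈ Finset.range n, ∑ j ∈ Finset.range n,
    C (star (w i) ⬝ᵥ (X : Matrix (Fin n) (Fin n) ℂ).mulVec (w j)) * Polynomial.X ^ (n - 1 - i + j)
  have hdeg : P.natDegree ≤ 2 * (n - 1) := by
    refine natDegree_sum_le_of_forall_le _ _ fun i hi =>
      natDegree_sum_le_of_forall_le _ _ fun j hj => (natDegree_C_mul_X_pow_le _ _).trans ?_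
    rw [Finset.mem_range] at hi hj
    omega
  have hP : ∀ z : ℂ, ‖z‖ = 1 → P.eval z = z ^ (n - 1) * (r z : ℂ) := by
    intro z hz
    have hz0 : z ≠ 0 := by
      rintro rfl
      simp at hz
    have hzz : z * star z = 1 := by
      rw [Complex.star_def, Complex.mul_conj, Complex.normSq_eq_norm_sq, hz]
      simp
    have hre : (r z : ℂ) =
        star (numer A B z) ⬝ᵥ (X : Matrix (Fin n) (Fin n) ℂ).mulVec (numer A B z) :=
      Complex.ext (by simp [r]) (by rw [Complex.ofReal_im, im_star_dotProduct_mulVec])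
    rw [hre, numer, star_sum, Matrix.mulVec_sum, sum_dotProduct, Finset.mul_sum, eval_finsetSum]
    refine Finset.sum_congr rfl fun i hi => ?_
    rw [dotProduct_sum, Finset.mul_sum, eval_finsetSum]
    refine Finset.sum_congr rfl fun j hj => ?_
    rw [eval_mul, eval_C, eval_pow, eval_X, star_smul, Matrix.mulVec_smul, smul_dotProduct,
      dotProduct_smul, star_pow, smul_eq_mul, smul_eq_mul, pow_add]
    have h : z ^ (n - 1) * star z ^ i = z ^ (n - 1 - i) := by
      rw [Finset.mem_range] at hi
      obtain ⟨k, hk⟩ := Nat.exists_eq_add_of_le (show i ≤ n - 1 by omega)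
      rw [hk, Nat.add_sub_cancel_left, pow_add, mul_right_comm, ← mul_pow, hzz, one_pow, one_mul]
    rw [← h]
    ring
  obtain ⟨q, hq, hqr⟩ := exists_norm_sq_eval_eq (n - 1) P r hdeg hr hP
  obtain ⟨c, hc⟩ := exists_dotProduct_numerCoeff hn hAB fun i => q.coeff i
  have hcq : ∀ z, c ⬝ᵥ numer A B z = q.eval z := by
    intro z
    rw [eval_eq_sum_range' (show q.natDegree < n by omega), numer, dotProduct_sum]
    refine Finset.sum_congr rfl fun i hi => ?_
    rw [dotProduct_smul, smul_eq_mul, hc ⟨i, Finset.mem_range.mp hi⟩, mul_comm]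
  have hpsd := posSemidef_vecMulVec_star_self c
  refine ⟨⟨vecMulVec (star c) c, hpsd.1⟩, hpsd, fun z => ?_⟩
  have h1 : c ⬝ᵥ transfer A B z = (A.charpoly.eval (z : ℂ))⁻¹ * q.eval (z : ℂ) := by
    rw [transfer_eq_numer hA (Circle.norm_coe z), dotProduct_smul, hcq, smul_eq_mul]
  rw [hrX, ← hqr z (Circle.norm_coe z), ← mul_pow, ← norm_inv, ← norm_mul, ← h1, quad]
  show (star _ ⬝ᵥ (vecMulVec (star c) c).mulVec _).re = _
  rw [vecMulVec_mulVec, dotProduct_smul, star_dotProduct_star, op_smul_eq_mul,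
    Complex.star_def, mul_comm, Complex.mul_conj, Complex.ofReal_re, Complex.normSq_eq_norm_sq]

open scoped ComplexOrder in
-- Strict positivity leaves room to subtract `εI` before taking the semidefinite representative;
-- adding it back makes the result definite. Here `ε` is half the minimum of `G*XG / G*G`.
theorem exists_posDef_quad_eq (hn : 0 < n) (hA : IsStable A) (hAB : IsReachable A B)
    {X : Herm n} (hX : ∀ z, 0 < quad A B X z) :
    ∃ Y : Herm n, (Y : Matrix (Fin n) (Fin n) ℂ).PosDef ∧ ∀ z, quad A B Y z = quad A B X z := by
  have h1 := quad_one_pos hn hA hAB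
  obtain ⟨z₀, -, hz₀⟩ := isCompact_univ.exists_isMinOn Set.univ_nonempty
    ((continuous_quad hA X).div (continuous_quad hA 1) fun z => (h1 z).ne').continuousOn
  set ε := quad A B X z₀ / quad A B 1 z₀ / 2 with hε
  have hε0 : 0 < ε := half_pos (div_pos (hX _) (h1 _))
  obtain ⟨Y, hY, hYq⟩ := exists_vecMulVec_quad_eq hn hA hAB (X := X - ε • 1) fun z => by
    have h := hz₀ (Set.mem_univ z)
    have h2 : ε < quad A B X z / quad A B 1 z := lt_of_lt_of_le (half_lt_self (by linarith)) h
    rw [lt_div_iff₀ (h1 z)] at h2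
    rw [quad_sub, quad_smul]
    linarith
  refine ⟨ε • 1 + Y, ?_, fun z => ?_⟩
  · exact ((Matrix.PosDef.one (n := Fin n) (R := ℂ)).smul hε0).add_posSemidef hY
  · rw [quad_add, hYq, quad_sub]
    ring

end

/-! ### Openness of the definite cone; affine and convex structure of the solutions -/

section

variable {n : ℕ} {A : Matrix (Fin n) (Fin n) ℂ} {B : Fin n → ℂ}

open scoped ComplexOrder in
theorem posDef_iff_re_pos (X : Herm n) :
    (X : Matrix (Fin n) (Fin n) ℂ).PosDef ↔ ∀ x : Fin n → ℂ, x ≠ 0 →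
      0 < (star x ⬝ᵥ (X : Matrix (Fin n) (Fin n) ℂ).mulVec x).re := by
  refine ⟨fun h x hx => h.re_dotProduct_pos hx, fun h => ?_⟩
  refine Matrix.PosDef.of_dotProduct_mulVec_pos X.2 fun x hx => ?_
  rw [Complex.lt_def]
  exact ⟨h x hx, (im_star_dotProduct_mulVec X x).symm⟩

theorem posDef_iff_re_pos_of_norm_eq_one (X : Herm n) :
    (open scoped ComplexOrder in (X : Matrix (Fin n) (Fin n) ℂ).PosDef) ↔
      ∀ x ∈ Metric.sphere (0 : Fin n → ℂ) 1,
        0 < (star x ⬝ᵥ (X : Matrix (Fin n) (Fin n) ℂ).mulVec x).re := by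
  rw [posDef_iff_re_pos]
  refine ⟨fun h x hx => h x (ne_zero_of_mem_unit_sphere ⟨x, hx⟩), fun h x hx => ?_⟩
  have hx0 : 0 < ‖x‖ := norm_pos_iff.mpr hx
  have h1 := h (((‖x‖⁻¹ : ℝ) : ℂ) • x) (by
    rw [mem_sphere_zero_iff_norm, norm_smul, Complex.norm_real, norm_inv, norm_norm,
      inv_mul_cancel₀ hx0.ne'])
  rw [star_smul, Matrix.mulVec_smul, smul_dotProduct, dotProduct_smul, smul_smul, Complex.star_def,
    Complex.conj_ofReal, ← Complex.ofReal_mul, smul_eq_mul, Complex.re_ofReal_mul] at h1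
  exact (pos_iff_pos_of_mul_pos h1).mp (by positivity)

open scoped ComplexOrder in
-- Positivity need only be checked on the compact unit sphere, where joint continuity makes it
-- stable under small changes of the matrix.
theorem isOpen_setOf_posDef :
    IsOpen {X : Herm n | (X : Matrix (Fin n) (Fin n) ℂ).PosDef} := by
  rw [isOpen_iff_mem_nhds]
  intro X hX
  have hX' := (posDef_iff_re_pos_of_norm_eq_one X).mp hX
  have hc : Continuous fun p : Herm n × (Fin n → ℂ) =>
      (star p.2 ⬝ᵥ (p.1 : Matrix (Fin n) (Fin n) ℂ).mulVec p.2).re :=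
    Complex.continuous_re.comp (continuous_snd.star.dotProduct
      ((continuous_subtype_val.comp continuous_fst).matrix_mulVec continuous_snd))
  have h := (isCompact_sphere (0 : Fin n → ℂ) 1).eventually_forall_of_forall_eventually
    (x₀ := X) (P := fun Y x => 0 < (star x ⬝ᵥ (Y : Matrix (Fin n) (Fin n) ℂ).mulVec x).re)
    fun x hx => hc.continuousAt.eventually_mem (Ioi_mem_nhds (hX' x hx))
  filter_upwards [h] with Y hY
  exact (posDef_iff_re_pos_of_norm_eq_one Y).mpr hY

open scoped ComplexOrder in
/-- Near a positive definite matrix, all matrices are positive definite. -/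
theorem exists_add_smul_posDef {Y : Herm n} (hY : (Y : Matrix (Fin n) (Fin n) ℂ).PosDef)
    (X : Herm n) : ∃ ε : ℝ, 0 < ε ∧ ∀ t : ℝ, |t| < ε →
      ((Y + t • X : Herm n) : Matrix (Fin n) (Fin n) ℂ).PosDef := by
  have hc : Continuous fun t : ℝ => Y + t • X := by
    refine Continuous.subtype_mk (f := fun t : ℝ =>
      (Y : Matrix (Fin n) (Fin n) ℂ) + t • (X : Matrix (Fin n) (Fin n) ℂ)) ?_ _
    fun_prop
  have h := hc.continuousAt.eventually_mem (x := 0)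
    (isOpen_setOf_posDef.mem_nhds (by simpa using hY))
  obtain ⟨ε, hε, h⟩ := Metric.eventually_nhds_iff.mp h
  exact ⟨ε, hε, fun t ht => h (by simpa using ht)⟩

theorem mem_solutions_of_quad_eq {Ψ : C(Circle, ℝ)} {X Y : Herm n}
    (hX : X ∈ solutions A B Ψ) (h : ∀ z, quad A B Y z = quad A B X z) : Y ∈ solutions A B Ψ := by
  obtain ⟨h1, h2⟩ := hX
  exact ⟨fun z => by rw [h]; exact h1 z, by simpa only [h] using h2⟩

/-- Both moment matrices equal `I`, so pairing each with `X - Y` gives the same mean. The difference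
of the integrands is a positive weight times a square. -/
theorem quad_eq_of_mem_solutions (hA : IsStable A) {Ψ : C(Circle, ℝ)} (hΨ : ∀ z, 0 < Ψ z)
    {X Y : Herm n} (hX : X ∈ solutions A B Ψ) (hY : Y ∈ solutions A B Ψ) (z : Circle) :
    quad A B X z = quad A B Y z := by
  have cX := continuous_div_quad hA Ψ hX.1
  have cY := continuous_div_quad hA Ψ hY.1
  have hX1 := trace_mul_momentMatrix (B := B) hA (X - Y) cX
  have hY1 := trace_mul_momentMatrix (B := B) hA (X - Y) cY
  rw [hX.2] at hX1
  rw [hY.2, hX1, Complex.ofReal_inj] at hY1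
  have cq := continuous_quad (B := B) hA (X - Y)
  have c1 : Continuous fun z => Ψ z / quad A B Y z * quad A B (X - Y) z := cY.mul cq
  have c2 : Continuous fun z => Ψ z / quad A B X z * quad A B (X - Y) z := cX.mul cq
  have h := circMean_sub c1 c2
  rw [← hY1, sub_self] at h
  have he : ∀ z, Ψ z / quad A B Y z * quad A B (X - Y) z - Ψ z / quad A B X z * quad A B (X - Y) z
      = Ψ z / (quad A B X z * quad A B Y z) * (quad A B X z - quad A B Y z) ^ 2 := fun z => by
    have h1 := (hX.1 z).ne'
    have h2 := (hY.1 z).ne'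
    rw [quad_sub]
    field_simp
  have h3 := eq_zero_of_circMean_eq_zero (c1.sub c2) (fun z => by
    rw [Pi.sub_apply, he]
    have h1 := hX.1 z
    have h2 := hY.1 z
    have h4 := hΨ z
    positivity) h z
  rw [Pi.sub_apply, he] at h3
  have h5 := (mul_eq_zero.mp h3).resolve_left
    (div_pos (hΨ z) (mul_pos (hX.1 z) (hY.1 z))).ne'
  exact sub_eq_zero.mp (pow_eq_zero_iff two_ne_zero |>.mp h5)

theorem solutions_eq_mk' (hA : IsStable A) {Ψ : C(Circle, ℝ)} (hΨ : ∀ z, 0 < Ψ z) {X : Herm n}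
    (hX : X ∈ solutions A B Ψ) : solutions A B Ψ =
      (AffineSubspace.mk' X (orthCompl (Set.range (Gam A B))) : Set (Herm n)) := by
  ext Y
  rw [SetLike.mem_coe, AffineSubspace.mem_mk', vsub_eq_sub, mem_orthCompl_iff hA]
  constructor
  · intro hY z
    rw [quad_sub, quad_eq_of_mem_solutions hA hΨ hY hX, sub_self]
  · intro h
    exact mem_solutions_of_quad_eq hX fun z => sub_eq_zero.mp (by rw [← quad_sub, h])

theorem convex_posSolutions (hA : IsStable A) {Ψ : C(Circle, ℝ)} (hΨ : ∀ z, 0 < Ψ z) :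
    Convex ℝ (posSolutions A B Ψ) := by
  rintro X ⟨hX, hXp⟩ Y ⟨hY, hYp⟩ a b ha hb hab
  refine ⟨?_, ?_⟩
  · refine mem_solutions_of_quad_eq hX fun z => ?_
    rw [quad_add, quad_smul, quad_smul, quad_eq_of_mem_solutions hA hΨ hY hX, ← add_mul, hab,
      one_mul]
  · rw [posDef_iff_re_pos] at hXp hYp ⊢
    intro x hx
    have h : (star x ⬝ᵥ ((a • X + b • Y : Herm n) : Matrix (Fin n) (Fin n) ℂ).mulVec x).re =
        a * (star x ⬝ᵥ (X : Matrix (Fin n) (Fin n) ℂ).mulVec x).re +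
        b * (star x ⬝ᵥ (Y : Matrix (Fin n) (Fin n) ℂ).mulVec x).re := by
      simp [Matrix.add_mulVec, Matrix.smul_mulVec]
    rw [h]
    exact (convex_Ioi (0 : ℝ)) (hXp x hx) (hYp x hx) ha hb hab

end

/-! ### First-order optimality and divergence at a double zero -/

section

theorem circMean_const_mul (c : ℝ) (f : Circle → ℝ) :
    circMean (fun z => c * f z) = c * circMean f := by
  rw [circMean, intervalIntegral.integral_const_mul, mul_left_comm, circMean]

/-- A quadratic lower bound that replaces differentiation under the integral. The gap left by `1 -
1/(1 + x) ≤ log (1 + x)` is `x²(1 + 2x)/(1 + x)`, whence the threshold `-1/2`. -/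
theorem le_log_one_add {x : ℝ} (hx : -(1 / 2) ≤ x) : x - 2 * x ^ 2 ≤ Real.log (1 + x) := by
  have h0 : 0 < 1 + x := by linarith
  refine le_trans ?_ (Real.one_sub_inv_le_log_of_pos h0)
  have h : 1 - (1 + x)⁻¹ - (x - 2 * x ^ 2) = x ^ 2 * (1 + 2 * x) / (1 + x) := by
    field_simp
    ring
  have h1 : 0 ≤ x ^ 2 * (1 + 2 * x) / (1 + x) :=
    div_nonneg (mul_nonneg (sq_nonneg x) (by linarith)) h0.le
  linarith

/-- First-order optimality condition for the mean logarithm. -/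
theorem circMean_mul_div_le_of_log_le {Ψ p q : Circle → ℝ} (hΨ : Continuous Ψ) (hp : Continuous p)
    (hq : Continuous q) (hΨ0 : ∀ z, 0 < Ψ z) (hp0 : ∀ z, 0 < p z) (hq0 : ∀ z, 0 < q z)
    (h : ∀ t : ℝ, 0 < t → t < 1 → circMean (fun z => Ψ z * Real.log ((1 - t) * p z + t * q z)) ≤
      circMean fun z => Ψ z * Real.log (p z)) :
    circMean (fun z => Ψ z / p z * q z) ≤ circMean Ψ := by
  have hpne : ∀ z, p z ≠ 0 := fun z => (hp0 z).ne'
  have cf : Continuous fun z => Ψ z * ((q z - p z) / p z) := hΨ.mul ((hq.sub hp).div hp hpne)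
  have cg : Continuous fun z => Ψ z * ((q z - p z) / p z) ^ 2 :=
    hΨ.mul (((hq.sub hp).div hp hpne).pow 2)
  set D := circMean fun z => Ψ z * ((q z - p z) / p z) with hD
  set E := circMean fun z => Ψ z * ((q z - p z) / p z) ^ 2 with hE
  -- Since `(q - p)/p > -1`, the bound `t ≤ 1/2` keeps the logarithm estimate applicable.
  have key : ∀ t : ℝ, 0 < t → t ≤ 1 / 2 → D ≤ t * (2 * E) := by
    intro t ht ht2
    have hpos : ∀ z, 0 < (1 - t) * p z + t * q z := fun z =>
      add_pos (mul_pos (by linarith) (hp0 z)) (mul_pos ht (hq0 z))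
    have cl : Continuous fun z => Ψ z * Real.log ((1 - t) * p z + t * q z) :=
      hΨ.mul (((continuous_const.mul hp).add (continuous_const.mul hq)).log fun z => (hpos z).ne')
    have cp : Continuous fun z => Ψ z * Real.log (p z) := hΨ.mul (hp.log hpne)
    have hle : ∀ z, t * (Ψ z * ((q z - p z) / p z)) ≤
        (Ψ z * Real.log ((1 - t) * p z + t * q z) - Ψ z * Real.log (p z)) +
          2 * t ^ 2 * (Ψ z * ((q z - p z) / p z) ^ 2) := by
      intro z
      have hx : -(1 / 2) ≤ t * ((q z - p z) / p z) := by
        have : -1 ≤ (q z - p z) / p z := by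
          rw [le_div_iff₀ (hp0 z)]
          linarith [hq0 z]
        nlinarith
      have hl := le_log_one_add hx
      have he : Real.log ((1 - t) * p z + t * q z) - Real.log (p z) =
          Real.log (1 + t * ((q z - p z) / p z)) := by
        rw [← Real.log_div (hpos z).ne' (hpne z)]
        congr 1
        field_simp [hpne z]
        ring
      rw [← mul_sub, he]
      have := mul_le_mul_of_nonneg_left hl (hΨ0 z).le
      nlinarith
    have c1 : Continuous fun z => Ψ z * Real.log ((1 - t) * p z + t * q z) -
        Ψ z * Real.log (p z) := cl.sub cp
    have c2 : Continuous fun z => 2 * t ^ 2 * (Ψ z * ((q z - p z) / p z) ^ 2) :=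
      continuous_const.mul cg
    have c3 : Continuous fun z => t * (Ψ z * ((q z - p z) / p z)) := continuous_const.mul cf
    have h1 := circMean_mono c3 (c1.add c2) hle
    simp only [Pi.add_def] at h1
    rw [circMean_add c1 c2, circMean_sub cl cp,
      circMean_const_mul, circMean_const_mul] at h1
    have h2 := h t ht (by linarith)
    have h3 : t * D ≤ t * (t * (2 * E)) := by
      rw [← hD, ← hE] at h1
      linarith
    exact le_of_mul_le_mul_left h3 ht
  have hD0 : D ≤ 0 := by
    by_contra! hD0
    have hE0 : 0 < E := by
      have := key (1 / 2) (by norm_num) le_rfl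
      linarith
    -- This `t` would give `D ≤ D / 2`.
    have h1 := key (min (1 / 2) (D / (4 * E))) (by positivity) (min_le_left _ _)
    have h2 : min (1 / 2) (D / (4 * E)) * (2 * E) ≤ D / (4 * E) * (2 * E) :=
      mul_le_mul_of_nonneg_right (min_le_right _ _) (by positivity)
    have h3 : D / (4 * E) * (2 * E) = D / 2 := by
      field_simp
      ring
    linarith
  have h4 := circMean_add cf hΨ
  have h5 : (fun z => Ψ z * ((q z - p z) / p z) + Ψ z) = fun z => Ψ z / p z * q z := by
    funext z
    field_simp [hpne z]
    ring
  rw [h5] at h4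
  rw [h4]
  linarith

/-- Functions dominated, up to small constants, by a function with a double zero have reciprocals
of unbounded mean. -/
theorem not_circMean_inv_bounded {q : Circle → ℝ} {t₀ s K m c : ℝ} (hs : 0 < s)
    (hK : 0 ≤ K) (hm : 0 < m)
    (hq : ∀ t, t₀ ≤ t → t ≤ t₀ + s → q (Circle.exp t) ≤ K * (t - t₀) ^ 2)
    (h : ∀ η : ℝ, 0 < η → ∃ p : Circle → ℝ, Continuous p ∧ (∀ z, 0 < p z) ∧
      (∀ z, p z ≤ q z + η) ∧ circMean (fun z => m / p z) ≤ c) : False := by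
  have key : ∀ ε : ℝ, 0 < ε → ε ≤ s → ε ≤ 2 * Real.pi →
      m ≤ ε * (2 * Real.pi * c * (K + 1)) := by
    intro ε hε hεs hεπ
    -- With `η = ε²`, `p ≤ (K + 1) ε²` on an arc of length `ε`, which alone contributes at least `m
    -- / ((K + 1) ε)`.
    obtain ⟨p, hpc, hp0, hpq, hc⟩ := h (ε ^ 2) (by positivity)
    have hcont : Continuous fun t : ℝ => m / p (Circle.exp t) :=
      continuous_const.div (hpc.comp Circle.exp.continuous) fun t => (hp0 _).ne'
    have hper : Function.Periodic (fun t : ℝ => m / p (Circle.exp t)) (2 * Real.pi) := fun t => by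
      simp only [Circle.periodic_exp t]
    have h1 : ∫ t in (-Real.pi)..Real.pi, m / p (Circle.exp t) =
        ∫ t in t₀..(t₀ + 2 * Real.pi), m / p (Circle.exp t) := by
      rw [← hper.intervalIntegral_add_eq (-Real.pi) t₀]
      congr 1
      ring
    have h2 : ∫ t in t₀..(t₀ + ε), m / p (Circle.exp t) ≤
        ∫ t in t₀..(t₀ + 2 * Real.pi), m / p (Circle.exp t) :=
      intervalIntegral.integral_mono_interval le_rfl (by linarith) (by linarith)
        (Filter.Eventually.of_forall fun t => (div_pos hm (hp0 _)).le)
        (hcont.intervalIntegrable _ _)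
    have h3 : ∫ _ in t₀..(t₀ + ε), m / ((K + 1) * ε ^ 2) ≤
        ∫ t in t₀..(t₀ + ε), m / p (Circle.exp t) := by
      refine intervalIntegral.integral_mono_on (by linarith) intervalIntegrable_const
        (hcont.intervalIntegrable _ _) fun t ht => ?_
      refine div_le_div_of_nonneg_left hm.le (hp0 _) ?_
      have h4 := hq t ht.1 (by linarith [ht.2])
      have h5 : K * (t - t₀) ^ 2 ≤ K * ε ^ 2 :=
        mul_le_mul_of_nonneg_left (pow_le_pow_left₀ (by linarith [ht.1]) (by linarith [ht.2]) 2) hK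
      linarith [hpq (Circle.exp t)]
    rw [intervalIntegral.integral_const, smul_eq_mul, add_sub_cancel_left] at h3
    have h4 : ε * (m / ((K + 1) * ε ^ 2)) = m / ((K + 1) * ε) := by
      field_simp
    rw [circMean, inv_mul_le_iff₀ (by positivity)] at hc
    have h5 : m / ((K + 1) * ε) ≤ 2 * Real.pi * c := by linarith
    rw [div_le_iff₀ (by positivity)] at h5
    linarith
  set L := 2 * Real.pi * c * (K + 1) with hL
  have hL0 : 0 < L := by
    by_contra! hL0
    have h1 := key (min s (2 * Real.pi)) (by positivity) (min_le_left _ _) (min_le_right _ _)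
    have h2 : min s (2 * Real.pi) * L ≤ 0 := mul_nonpos_of_nonneg_of_nonpos (by positivity) hL0
    linarith
  have h1 := key (min (min s (2 * Real.pi)) (m / (2 * L))) (by positivity)
    ((min_le_left _ _).trans (min_le_left _ _)) ((min_le_left _ _).trans (min_le_right _ _))
  have h2 : min (min s (2 * Real.pi)) (m / (2 * L)) * L ≤ m / (2 * L) * L :=
    mul_le_mul_of_nonneg_right (min_le_right _ _) hL0.le
  have h3 : m / (2 * L) * L = m / 2 := by field_simp
  linarith

end

/-! ### Existence by constrained maximization and passage to the limit -/

section

variable {n : ℕ} {A : Matrix (Fin n) (Fin n) ℂ} {B : Fin n → ℂ}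

/-- The Hermitian matrix `C* C`. -/
def gramHerm (C : Matrix (Fin n) (Fin n) ℂ) : Herm n :=
  ⟨Cᴴ * C, isHermitian_conjTranspose_mul_self C⟩

/-- The square of the Frobenius norm. -/
def normSqSum (C : Matrix (Fin n) (Fin n) ℂ) : ℝ := ∑ i, ∑ j, ‖C i j‖ ^ 2

theorem trace_gramHerm (C : Matrix (Fin n) (Fin n) ℂ) :
    (gramHerm C : Matrix (Fin n) (Fin n) ℂ).trace = normSqSum C := by
  simp only [gramHerm, Matrix.trace, Matrix.diag_apply, Matrix.mul_apply, normSqSum,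
    Matrix.conjTranspose_apply]
  rw [Finset.sum_comm]
  push_cast
  refine Finset.sum_congr rfl fun i _ => Finset.sum_congr rfl fun j _ => ?_
  rw [← Complex.ofReal_pow, ← Complex.normSq_eq_norm_sq, ← Complex.mul_conj, mul_comm,
    Complex.star_def]

theorem continuous_normSqSum : Continuous (normSqSum (n := n)) := by
  unfold normSqSum
  exact continuous_finsetSum _ fun i _ => continuous_finsetSum _ fun j _ =>
    (continuous_id.matrix_elem i j).norm.pow 2

theorem isCompact_normSqSum_le (s : ℝ) :
    IsCompact {C : Matrix (Fin n) (Fin n) ℂ | normSqSum C ≤ s} := by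
  have hK : IsCompact (Set.pi Set.univ fun _ : Fin n => Set.pi Set.univ fun _ : Fin n =>
      Metric.closedBall (0 : ℂ) (s + 1)) :=
    isCompact_univ_pi fun _ => isCompact_univ_pi fun _ => isCompact_closedBall _ _
  refine IsCompact.of_isClosed_subset (X := Matrix (Fin n) (Fin n) ℂ) hK
    (isClosed_le continuous_normSqSum continuous_const) ?_
  intro C hC i _ j _
  have h1 : ‖C i j‖ ^ 2 ≤ s := by
    refine le_trans ?_ hC
    refine le_trans ?_ (Finset.single_le_sum (f := fun i => ∑ j, ‖C i j‖ ^ 2)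
      (fun i _ => Finset.sum_nonneg fun j _ => sq_nonneg _) (Finset.mem_univ i))
    exact Finset.single_le_sum (f := fun j => ‖C i j‖ ^ 2) (fun j _ => sq_nonneg _)
      (Finset.mem_univ j)
  rw [mem_closedBall_zero_iff]
  nlinarith [sq_nonneg (‖C i j‖ - 1)]

open scoped ComplexOrder MatrixOrder in
theorem exists_gramHerm_eq {X : Herm n} (hX : (X : Matrix (Fin n) (Fin n) ℂ).PosSemidef) :
    ∃ C, gramHerm C = X := by
  obtain ⟨C, hC⟩ := CStarAlgebra.nonneg_iff_eq_star_mul_self.mp hX.nonneg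
  exact ⟨C, Subtype.ext hC.symm⟩

open scoped ComplexOrder in
theorem posSemidef_gramHerm (C : Matrix (Fin n) (Fin n) ℂ) :
    (gramHerm C : Matrix (Fin n) (Fin n) ℂ).PosSemidef :=
  posSemidef_conjTranspose_mul_self C

open scoped ComplexOrder in
theorem quad_nonneg {X : Herm n} (hX : (X : Matrix (Fin n) (Fin n) ℂ).PosSemidef) (z : Circle) :
    0 ≤ quad A B X z :=
  hX.re_dotProduct_nonneg _

/-- The perturbed Gram matrices `δ I + C* C`. -/
def shiftGram (δ : ℝ) (C : Matrix (Fin n) (Fin n) ℂ) : Herm n := δ • 1 + gramHerm C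

theorem quad_shiftGram (δ : ℝ) (C : Matrix (Fin n) (Fin n) ℂ) (z : Circle) :
    quad A B (shiftGram δ C) z = δ * quad A B 1 z + quad A B (gramHerm C) z := by
  rw [shiftGram, quad_add, quad_smul]

theorem quad_shiftGram_pos (hn : 0 < n) (hA : IsStable A) (hAB : IsReachable A B) {δ : ℝ}
    (hδ : 0 < δ) (C : Matrix (Fin n) (Fin n) ℂ) (z : Circle) :
    0 < quad A B (shiftGram δ C) z := by
  rw [quad_shiftGram]
  exact add_pos_of_pos_of_nonneg (mul_pos hδ (quad_one_pos hn hA hAB z))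
    (quad_nonneg (posSemidef_gramHerm C) z)

theorem continuous_quad_shiftGram (hA : IsStable A) :
    Continuous fun p : (ℝ × Matrix (Fin n) (Fin n) ℂ) × Circle =>
      quad A B (shiftGram p.1.1 p.1.2) p.2 := by
  have hG : Continuous fun p : (ℝ × Matrix (Fin n) (Fin n) ℂ) × Circle => transfer A B p.2 :=
    (continuous_transfer hA).comp continuous_snd
  have hC : Continuous fun p : (ℝ × Matrix (Fin n) (Fin n) ℂ) × Circle => p.1.2 :=
    continuous_snd.comp continuous_fst
  have h1 : Continuous fun p : (ℝ × Matrix (Fin n) (Fin n) ℂ) × Circle =>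
      quad A B (gramHerm p.1.2) p.2 :=
    Complex.continuous_re.comp (hG.star.dotProduct
      ((hC.matrix_conjTranspose.matrix_mul hC).matrix_mulVec hG))
  simp_rw [quad_shiftGram]
  exact ((continuous_fst.comp continuous_fst).mul
    ((continuous_quad hA 1).comp continuous_snd)).add h1

theorem normSqSum_smul_one (s : ℝ) (hs : 0 ≤ s) :
    normSqSum ((Real.sqrt s : ℂ) • (1 : Matrix (Fin n) (Fin n) ℂ)) = n * s := by
  have h : ∀ i j : Fin n, ‖((Real.sqrt s : ℂ) • (1 : Matrix (Fin n) (Fin n) ℂ)) i j‖ ^ 2 =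
      if i = j then s else 0 := by
    intro i j
    rw [Matrix.smul_apply, Matrix.one_apply]
    split_ifs <;> simp [Real.sq_sqrt hs]
  simp only [normSqSum, h]
  simp

/-- Gram factors of fixed Frobenius norm form a compact set, and the shift by `δI` keeps the
logarithm continuous there. -/
theorem exists_maximizer (hn : 0 < n) (hA : IsStable A) (hAB : IsReachable A B)
    (Ψ : C(Circle, ℝ)) {δ s : ℝ} (hδ : 0 < δ) (hs : 0 ≤ s) :
    ∃ C : Matrix (Fin n) (Fin n) ℂ, normSqSum C = n * s ∧ ∀ C', normSqSum C' = n * s →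
      circMean (fun z => Ψ z * Real.log (quad A B (shiftGram δ C') z)) ≤
        circMean fun z => Ψ z * Real.log (quad A B (shiftGram δ C) z) := by
  have hK : IsCompact {C : Matrix (Fin n) (Fin n) ℂ | normSqSum C = n * s} :=
    (isCompact_normSqSum_le (n * s)).of_isClosed_subset
      (isClosed_eq continuous_normSqSum continuous_const) fun C hC => le_of_eq hC
  have hc : Continuous fun C : Matrix (Fin n) (Fin n) ℂ =>
      circMean fun z => Ψ z * Real.log (quad A B (shiftGram δ C) z) := by
    unfold circMean
    refine continuous_const.mul
      (intervalIntegral.continuous_parametric_intervalIntegral_of_continuous' ?_ _ _)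
    have hexp : Continuous fun p : Matrix (Fin n) (Fin n) ℂ × ℝ => Circle.exp p.2 :=
      Circle.exp.continuous.comp continuous_snd
    have h1 : Continuous fun p : Matrix (Fin n) (Fin n) ℂ × ℝ => Ψ (Circle.exp p.2) :=
      Ψ.continuous.comp hexp
    have h2 : Continuous fun p : Matrix (Fin n) (Fin n) ℂ × ℝ => ((δ, p.1), Circle.exp p.2) :=
      (continuous_const.prodMk continuous_fst).prodMk hexp
    have h3 := (continuous_quad_shiftGram (B := B) hA).comp h2
    simp only [Function.comp_def] at h3
    have h4 : Continuous fun p : Matrix (Fin n) (Fin n) ℂ × ℝ =>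
        Real.log (quad A B (shiftGram δ p.1) (Circle.exp p.2)) :=
      h3.log fun p => (quad_shiftGram_pos hn hA hAB hδ p.1 (Circle.exp p.2)).ne'
    have h5 := h1.mul h4
    simp only [Pi.mul_def] at h5
    exact h5
  obtain ⟨C, hC, hmax⟩ := hK.exists_isMaxOn ⟨_, normSqSum_smul_one s hs⟩ hc.continuousOn
  exact ⟨C, hC, fun C' hC' => hmax hC'⟩

open scoped ComplexOrder in
-- The sphere of factors `C` is not convex, but its image `δI + C*C` is the convex set of matrices
-- above `δI` with trace `n`. So segments from the maximizer are feasible, and the first-order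
-- condition applies along them.
theorem exists_kkt (hn : 0 < n) (hA : IsStable A) (hAB : IsReachable A B)
    {Ψ : C(Circle, ℝ)} (hΨ : ∀ z, 0 < Ψ z) {δ : ℝ} (hδ : 0 < δ) (hδ1 : δ < 1) :
    ∃ C : Matrix (Fin n) (Fin n) ℂ, normSqSum C = n * (1 - δ) ∧ ∀ Y : Herm n,
      ((Y - δ • 1 : Herm n) : Matrix (Fin n) (Fin n) ℂ).PosSemidef →
      (Y : Matrix (Fin n) (Fin n) ℂ).trace = n →
      circMean (fun z => Ψ z / quad A B (shiftGram δ C) z * quad A B Y z) ≤ circMean Ψ := by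
  obtain ⟨C, hC, hmax⟩ := exists_maximizer hn hA hAB Ψ hδ (s := 1 - δ) (by linarith)
  refine ⟨C, hC, fun Y hY htr => ?_⟩
  obtain ⟨D, hD⟩ := exists_gramHerm_eq hY
  have hYD : Y = shiftGram δ D := by
    rw [shiftGram, hD]
    abel
  have hDs : normSqSum D = n * (1 - δ) := by
    have h := trace_gramHerm D
    rw [hD] at h
    have h2 : ((Y - δ • 1 : Herm n) : Matrix (Fin n) (Fin n) ℂ).trace =
        ((n * (1 - δ) : ℝ) : ℂ) := by
      simp [htr, Matrix.trace_sub, Matrix.trace_smul]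
      ring
    rw [h2] at h
    exact (Complex.ofReal_inj.mp h).symm
  refine circMean_mul_div_le_of_log_le Ψ.continuous (continuous_quad hA _) (continuous_quad hA _)
    hΨ (quad_shiftGram_pos hn hA hAB hδ C)
    (fun z => by rw [hYD]; exact quad_shiftGram_pos hn hA hAB hδ D z) fun t ht ht1 => ?_
  have hpsd : (((1 - t) • gramHerm C + t • gramHerm D : Herm n) :
      Matrix (Fin n) (Fin n) ℂ).PosSemidef :=
    ((posSemidef_gramHerm C).smul (by linarith : (0 : ℝ) ≤ 1 - t)).add
      ((posSemidef_gramHerm D).smul ht.le)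
  obtain ⟨E, hE⟩ := exists_gramHerm_eq hpsd
  have hEs : normSqSum E = n * (1 - δ) := by
    have h := trace_gramHerm E
    rw [hE] at h
    have h2 : (((1 - t) • gramHerm C + t • gramHerm D : Herm n) :
        Matrix (Fin n) (Fin n) ℂ).trace = (((1 - t) * normSqSum C + t * normSqSum D : ℝ) : ℂ) := by
      simp [trace_gramHerm, Matrix.trace_add, Matrix.trace_smul]
    rw [h2, hC, hDs] at h
    have h3 := Complex.ofReal_inj.mp h
    linarith
  have h := hmax E hEs
  have he : ∀ z, quad A B (shiftGram δ E) z =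
      (1 - t) * quad A B (shiftGram δ C) z + t * quad A B Y z := fun z => by
    rw [hYD, quad_shiftGram, quad_shiftGram, quad_shiftGram, hE, quad_add, quad_smul, quad_smul]
    ring
  simpa only [he] using h

/-- If `G* C* C G` vanishes at a point of the unit circle, it does so to second order. -/
theorem exists_quad_gramHerm_le (hA : IsStable A) (C : Matrix (Fin n) (Fin n) ℂ) {t₀ : ℝ}
    (h0 : quad A B (gramHerm C) (Circle.exp t₀) = 0) :
    ∃ s K : ℝ, 0 < s ∧ 0 ≤ K ∧ ∀ t, t₀ ≤ t → t ≤ t₀ + s →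
      quad A B (gramHerm C) (Circle.exp t) ≤ K * (t - t₀) ^ 2 := by
  let v : ℝ → Fin n → ℂ := fun t => C.mulVec (transfer A B (Circle.exp t))
  have hq : ∀ t, quad A B (gramHerm C) (Circle.exp t) = ∑ i, ‖v t i‖ ^ 2 := by
    intro t
    show (star (transfer A B (Circle.exp t)) ⬝ᵥ
      (Cᴴ * C).mulVec (transfer A B (Circle.exp t))).re = _
    rw [← Matrix.mulVec_mulVec, Matrix.dotProduct_mulVec, ← Matrix.star_mulVec]
    simp only [dotProduct, Complex.re_sum, Pi.star_apply]
    refine Finset.sum_congr rfl fun i _ => ?_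
    rw [Complex.star_def, mul_comm, Complex.mul_conj, Complex.ofReal_re, Complex.normSq_eq_norm_sq]
  have hv0 : v t₀ = 0 := by
    rw [hq, Finset.sum_eq_zero_iff_of_nonneg fun i _ => sq_nonneg _] at h0
    ext i
    simpa using h0 i (Finset.mem_univ i)
  have hd : DifferentiableAt ℝ v t₀ :=
    ((C.mulVecLin.restrictScalars ℝ).toContinuousLinearMap.differentiableAt).comp t₀
      (differentiableAt_transfer_exp hA t₀)
  -- `G*C*CG` is `‖CG‖²`, and `CG` is differentiable and vanishes at `t₀`, hence is `O(t - t₀)`.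
  obtain ⟨c, hc⟩ := hd.isBigO_sub.bound
  obtain ⟨s, hs, hc⟩ := Metric.eventually_nhds_iff.mp hc
  refine ⟨s / 2, n * c ^ 2, half_pos hs, by positivity, fun t h1 h2 => ?_⟩
  have h3 := hc (y := t) (by
    rw [Real.dist_eq, abs_of_nonneg (by linarith)]
    linarith)
  rw [hv0, sub_zero] at h3
  rw [hq]
  have h4 : ∀ i ∈ Finset.univ, ‖v t i‖ ^ 2 ≤ c ^ 2 * (t - t₀) ^ 2 := fun i _ => by
    have h5 : ‖v t i‖ ≤ c * ‖t - t₀‖ := (norm_le_pi_norm _ i).trans h3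
    have h6 := pow_le_pow_left₀ (norm_nonneg _) h5 2
    rwa [mul_pow, Real.norm_eq_abs, sq_abs] at h6
  refine (Finset.sum_le_card_nsmul _ _ _ h4).trans (le_of_eq ?_)
  rw [Finset.card_univ, Fintype.card_fin, nsmul_eq_mul]
  ring

open scoped ComplexOrder in
theorem exists_optimal (hn : 0 < n) (hA : IsStable A) (hAB : IsReachable A B)
    {Ψ : C(Circle, ℝ)} (hΨ : ∀ z, 0 < Ψ z) :
    ∃ X : Herm n, (∀ z, 0 < quad A B X z) ∧ (X : Matrix (Fin n) (Fin n) ℂ).trace = n ∧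
      ∀ Y : Herm n, (Y : Matrix (Fin n) (Fin n) ℂ).PosDef →
        (Y : Matrix (Fin n) (Fin n) ℂ).trace = n →
        circMean (fun z => Ψ z / quad A B X z * quad A B Y z) ≤ circMean Ψ := by
  have hδ : ∀ k : ℕ, (0 : ℝ) < 1 / ((k : ℝ) + 1 + 1) := fun k => by positivity
  have hδ1 : ∀ k : ℕ, 1 / ((k : ℝ) + 1 + 1) < 1 := fun k => by
    rw [div_lt_one (by positivity)]
    linarith [(Nat.cast_nonneg k : (0 : ℝ) ≤ k)]
  set δ : ℕ → ℝ := fun k => 1 / ((k : ℝ) + 1 + 1) with hδdef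
  have hδlim : Tendsto δ atTop (𝓝 0) := by
    have h := (tendsto_one_div_add_atTop_nhds_zero_nat (𝕜 := ℝ)).comp (tendsto_add_atTop_nat 1)
    refine h.congr fun k => ?_
    simp [hδdef]
  choose C hCs hCk using fun k => exists_kkt hn hA hAB hΨ (hδ k) (hδ1 k)
  have : FirstCountableTopology (Matrix (Fin n) (Fin n) ℂ) :=
    inferInstanceAs (FirstCountableTopology (Fin n → Fin n → ℂ))
  obtain ⟨D, -, φ, hφ, hlim⟩ := (isCompact_normSqSum_le (n := n) n).tendsto_subseq (x := C)
    fun k => by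
      have h1 := hδ k
      rw [Set.mem_ofPred_eq, hCs]
      nlinarith [(Nat.cast_nonneg n : (0 : ℝ) ≤ n)]
  have hδφ : Tendsto (δ ∘ φ) atTop (𝓝 0) := hδlim.comp hφ.tendsto_atTop
  have hDs : normSqSum D = n := by
    have h1 := (continuous_normSqSum.tendsto D).comp hlim
    have h2 : Tendsto (fun k => (n : ℝ) * (1 - δ (φ k))) atTop (𝓝 (n * (1 - 0))) :=
      (tendsto_const_nhds.sub hδφ).const_mul _
    rw [sub_zero, mul_one] at h2
    exact tendsto_nhds_unique (h1.congr fun k => hCs (φ k)) h2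
  -- Currying turns joint continuity into convergence uniform on the compact circle.
  let Q := ContinuousMap.curry ⟨_, continuous_quad_shiftGram (B := B) hA⟩
  have hQ : Tendsto (fun k => Q (δ (φ k), C (φ k))) atTop (𝓝 (Q (0, D))) :=
    (Q.continuous.tendsto _).comp (hδφ.prodMk_nhds hlim)
  have hclose : ∀ η : ℝ, 0 < η → ∀ᶠ k in atTop, ∀ z,
      quad A B (shiftGram (δ (φ k)) (C (φ k))) z ≤ quad A B (gramHerm D) z + η := by
    intro η hη
    filter_upwards [Metric.tendsto_nhds.mp hQ η hη] with k hk z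
    have h1 := (ContinuousMap.dist_apply_le_dist z).trans_lt hk
    have h2 : |quad A B (shiftGram (δ (φ k)) (C (φ k))) z - quad A B (shiftGram 0 D) z| < η := h1
    rw [quad_shiftGram 0, zero_mul, zero_add] at h2
    linarith [(abs_lt.mp h2).2]
  have c1 := continuous_quad (B := B) hA 1
  have h1pos := quad_one_pos hn hA hAB
  have hpos : ∀ z, 0 < quad A B (gramHerm D) z := by
    intro z
    refine lt_of_le_of_ne (quad_nonneg (posSemidef_gramHerm D) z) fun h0 => ?_
    obtain ⟨s, K, hs, hK, hq⟩ := exists_quad_gramHerm_le (B := B) hA D (t₀ := (z : ℂ).arg) (by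
      rw [Circle.exp_arg, ← h0])
    obtain ⟨z₁, -, hz₁⟩ := isCompact_univ.exists_isMinOn Set.univ_nonempty
      (Ψ.continuous.mul c1).continuousOn
    -- Optimality tested at `Y = I` bounds the mean of `m / p`, where `m` is the minimum of `Ψ G*G`.
    refine not_circMean_inv_bounded (m := Ψ z₁ * quad A B 1 z₁) (c := circMean Ψ) hs hK
      (mul_pos (hΨ _) (h1pos _)) hq fun η hη => ?_
    obtain ⟨k, hk⟩ := (hclose η hη).exists
    have hp := quad_shiftGram_pos (B := B) hn hA hAB (hδ (φ k)) (C (φ k))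
    have cp := continuous_quad (B := B) hA (shiftGram (δ (φ k)) (C (φ k)))
    refine ⟨_, cp, hp, hk, ?_⟩
    refine le_trans ?_ (hCk (φ k) 1 ?_ (by simp))
    · refine circMean_mono (continuous_const.div cp fun z => (hp z).ne')
        ((Ψ.continuous.div cp fun z => (hp z).ne').mul c1) fun y => ?_
      rw [div_mul_eq_mul_div]
      exact div_le_div_of_nonneg_right (hz₁ (Set.mem_univ y)) (hp y).le
    · have h : (1 - δ (φ k) • 1 : Herm n) = (1 - δ (φ k)) • (1 : Herm n) := by
        rw [sub_smul, one_smul]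
      rw [h]
      exact Matrix.PosSemidef.one.smul (sub_nonneg.mpr (hδ1 _).le)
  refine ⟨gramHerm D, hpos, by rw [trace_gramHerm, hDs, Complex.ofReal_natCast], fun Y hY htr => ?_⟩
  have cD := continuous_quad (B := B) hA (gramHerm D)
  have cY := continuous_quad (B := B) hA Y
  have hYpos : ∀ z, 0 < quad A B Y z := fun z =>
    hY.re_dotProduct_pos (transfer_ne_zero hn hA hAB (Circle.norm_coe z))
  -- Definiteness of `Y` makes it a legitimate competitor, `Y ≥ δI`, for all small `δ`.
  obtain ⟨ε, hε, hYε⟩ := exists_add_smul_posDef hY (-1)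
  obtain ⟨z₀, -, hz₀⟩ := isCompact_univ.exists_isMinOn Set.univ_nonempty cD.continuousOn
  refine le_of_forall_pos_le_add fun b hb => ?_
  have hΨ0 : 0 < circMean Ψ := circMean_pos Ψ.continuous (fun z => (hΨ z).le) (hΨ 1)
  -- Uniform closeness makes the approximating form at most `1 + η` times the limit form; this `η`
  -- turns that factor into an error of exactly `b`.
  set η := b / circMean Ψ with hη
  have hη0 : 0 < η := div_pos hb hΨ0
  obtain ⟨k, hk, hkε⟩ := ((hclose (η * quad A B (gramHerm D) z₀) (mul_pos hη0 (hpos _))).and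
    (hδφ.eventually_lt_const hε)).exists
  have hp := quad_shiftGram_pos (B := B) hn hA hAB (hδ (φ k)) (C (φ k))
  have cp := continuous_quad (B := B) hA (shiftGram (δ (φ k)) (C (φ k)))
  have h1 := hCk (φ k) Y (by
    have h := (hYε (δ (φ k)) (by rw [abs_of_pos (hδ _)]; exact hkε)).posSemidef
    rwa [smul_neg, ← sub_eq_add_neg] at h) htr
  have h2 : circMean (fun z => Ψ z / quad A B (gramHerm D) z * quad A B Y z) ≤
      circMean fun z => (1 + η) *
        (Ψ z / quad A B (shiftGram (δ (φ k)) (C (φ k))) z * quad A B Y z) := by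
    refine circMean_mono ((continuous_div_quad hA Ψ hpos).mul cY)
      (continuous_const.mul ((continuous_div_quad hA Ψ hp).mul cY)) fun z => ?_
    rw [← mul_assoc]
    refine mul_le_mul_of_nonneg_right ?_ (hYpos z).le
    rw [← mul_div_assoc, div_le_div_iff₀ (hpos z) (hp z), mul_comm (1 + η), mul_assoc]
    refine mul_le_mul_of_nonneg_left ?_ (hΨ z).le
    have h3 : quad A B (gramHerm D) z₀ ≤ quad A B (gramHerm D) z := hz₀ (Set.mem_univ z)
    have h4 := hk z
    nlinarith
  rw [circMean_const_mul] at h2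
  have h3 : η * circMean Ψ = b := div_mul_cancel₀ _ hΨ0.ne'
  nlinarith

/-- A Hermitian matrix orthogonal to all Hermitian matrices of trace zero is a multiple of `I`. -/
theorem eq_smul_one_of_trace_mul_eq_zero (hn : 0 < n) (M : Herm n)
    (h : ∀ X : Herm n, (X : Matrix (Fin n) (Fin n) ℂ).trace = 0 →
      ((X : Matrix (Fin n) (Fin n) ℂ) * (M : Matrix (Fin n) (Fin n) ℂ)).trace = 0) :
    ∃ l : ℝ, (M : Matrix (Fin n) (Fin n) ℂ) = (l : ℂ) • 1 := by
  have hn0 : (n : ℂ) ≠ 0 := by exact_mod_cast hn.ne'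
  have hM : (M : Matrix (Fin n) (Fin n) ℂ).IsHermitian := M.2
  set l : ℝ := (M : Matrix (Fin n) (Fin n) ℂ).trace.re / n with hl
  have hlc : (l : ℂ) * n = (M : Matrix (Fin n) (Fin n) ℂ).trace := by
    have him : (M : Matrix (Fin n) (Fin n) ℂ).trace.im = 0 := by
      have h1 : star (M : Matrix (Fin n) (Fin n) ℂ).trace = (M : Matrix (Fin n) (Fin n) ℂ).trace := by
        rw [← Matrix.trace_conjTranspose, hM]
      exact Complex.conj_eq_iff_im.mp h1
    have h2 : (((M : Matrix (Fin n) (Fin n) ℂ).trace.re : ℝ) : ℂ) =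
        (M : Matrix (Fin n) (Fin n) ℂ).trace := Complex.ext (by simp) (by simp [him])
    rw [hl, Complex.ofReal_div, h2, Complex.ofReal_natCast, div_mul_cancel₀ _ hn0]
  have hcoe : ((M - l • 1 : Herm n) : Matrix (Fin n) (Fin n) ℂ) =
      (M : Matrix (Fin n) (Fin n) ℂ) - (l : ℂ) • 1 := by
    ext i j
    simp
  have htr : ((M - l • 1 : Herm n) : Matrix (Fin n) (Fin n) ℂ).trace = 0 := by
    rw [hcoe, Matrix.trace_sub, Matrix.trace_smul, Matrix.trace_one, Fintype.card_fin, smul_eq_mul,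
      hlc, sub_self]
  have h1 := h _ htr
  -- The traceless part of `M` is itself an admissible test matrix, so its Frobenius norm vanishes.
  have h2 : (((M - l • 1 : Herm n) : Matrix (Fin n) (Fin n) ℂ) *
      ((M - l • 1 : Herm n) : Matrix (Fin n) (Fin n) ℂ)).trace = 0 := by
    conv_lhs => enter [1, 2]; rw [hcoe]
    rw [mul_sub, Matrix.trace_sub, h1, Matrix.mul_smul, mul_one, Matrix.trace_smul, htr, smul_zero,
      sub_zero]
  have hs : ((M - l • 1 : Herm n) : Matrix (Fin n) (Fin n) ℂ)ᴴ =
      ((M - l • 1 : Herm n) : Matrix (Fin n) (Fin n) ℂ) := (M - l • 1 : Herm n).2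
  open scoped ComplexOrder in
  have h3 := (Matrix.trace_conjTranspose_mul_self_eq_zero_iff
    (A := ((M - l • 1 : Herm n) : Matrix (Fin n) (Fin n) ℂ))).mp (by rw [hs, h2])
  rw [hcoe, sub_eq_zero] at h3
  exact ⟨l, h3⟩

open scoped ComplexOrder in
theorem posSolutions_nonempty (hn : 0 < n) (hA : IsStable A) (hAB : IsReachable A B)
    {Ψ : C(Circle, ℝ)} (hΨ : ∀ z, 0 < Ψ z) (hI : (1 : Herm n) ∈ Set.range (Gam A B)) :
    (posSolutions A B Ψ).Nonempty := by
  obtain ⟨X, hX, hXtr, hopt⟩ := exists_optimal hn hA hAB hΨ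
  obtain ⟨Y, hY, hYX⟩ := exists_posDef_quad_eq hn hA hAB hX
  have hYtr : (Y : Matrix (Fin n) (Fin n) ℂ).trace = n := by
    rw [trace_eq_of_quad_eq hA hI hYX, hXtr]
  have hY0 : ∀ z, 0 < quad A B Y z := fun z => by rw [hYX]; exact hX z
  have cY := continuous_div_quad hA Ψ hY0
  have hΨ0 : 0 < circMean Ψ := circMean_pos Ψ.continuous (fun z => (hΨ z).le) (hΨ 1)
  have hYY : circMean (fun z => Ψ z / quad A B Y z * quad A B Y z) = circMean Ψ :=
    congrArg circMean (funext fun z => div_mul_cancel₀ (Ψ z) (hY0 z).ne')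
  simp_rw [← hYX] at hopt
  obtain ⟨M, hM⟩ : ∃ M : Herm n, (M : Matrix (Fin n) (Fin n) ℂ) =
      momentMatrix A B fun z => Ψ z / quad A B Y z :=
    ⟨Gam A B ⟨_, cY⟩, rfl⟩
  have hMtr : ∀ Z : Herm n, ((Z : Matrix (Fin n) (Fin n) ℂ) * (M : Matrix (Fin n) (Fin n) ℂ)).trace =
      (circMean fun z => Ψ z / quad A B Y z * quad A B Z z : ℝ) := fun Z => by
    rw [hM, trace_mul_momentMatrix hA Z cY]
  obtain ⟨l, hl⟩ := eq_smul_one_of_trace_mul_eq_zero hn M fun Z hZ => by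
    rw [hMtr, Complex.ofReal_eq_zero]
    have cZ := continuous_quad (B := B) hA Z
    obtain ⟨ε, hε, hεp⟩ := exists_add_smul_posDef hY Z
    -- `Y` is interior to the cone, so traceless perturbations of either sign are allowed and the
    -- one-sided inequality becomes an equality.
    have key : ∀ t : ℝ, |t| < ε → t * circMean (fun z => Ψ z / quad A B Y z * quad A B Z z) ≤ 0 := by
      intro t ht
      have h := hopt (Y + t • Z) (hεp t ht) (by simp [hYtr, hZ])
      have he : (fun z => Ψ z / quad A B Y z * quad A B (Y + t • Z) z) = fun z =>
          Ψ z / quad A B Y z * quad A B Y z + t * (Ψ z / quad A B Y z * quad A B Z z) := by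
        funext z
        rw [quad_add, quad_smul]
        ring
      have c1 : Continuous fun z => Ψ z / quad A B Y z * quad A B Y z :=
        cY.mul (continuous_quad (B := B) hA Y)
      have c2 : Continuous fun z => t * (Ψ z / quad A B Y z * quad A B Z z) :=
        continuous_const.mul (cY.mul cZ)
      rw [he, circMean_add c1 c2, hYY, circMean_const_mul] at h
      linarith
    have h1 := key (ε / 2) (by rw [abs_of_pos (by linarith)]; linarith)
    have h2 := key (-(ε / 2)) (by rw [abs_neg, abs_of_pos (by linarith)]; linarith)
    nlinarith
  -- Pairing with `Y` itself determines `l` and shows that it is positive.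
  have hln : l * n = circMean Ψ := by
    have h := hMtr Y
    rw [hl, hYY, Matrix.mul_smul, mul_one, Matrix.trace_smul, hYtr, smul_eq_mul] at h
    exact_mod_cast h
  have hl0 : 0 < l := by
    have hn' : (0 : ℝ) < n := by exact_mod_cast hn
    by_contra! hl0
    nlinarith
  have hquad : ∀ z, quad A B (l • Y) z = l * quad A B Y z := fun z => quad_smul l Y z
  refine ⟨l • Y, ⟨fun z => ?_, ?_⟩, hY.smul hl0⟩
  · rw [hquad]
    exact mul_pos hl0 (hY0 z)
  · have he : (fun z => Ψ z / quad A B (l • Y) z) = fun z => l⁻¹ * (Ψ z / quad A B Y z) := by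
      funext z
      rw [hquad, div_mul_eq_div_div_swap, div_eq_inv_mul]
    rw [he, momentMatrix_smul, ← hM, hl, smul_smul, Complex.ofReal_inv,
      inv_mul_cancel₀ (by exact_mod_cast hl0.ne'), one_smul]

end

end SpectralMoment

end

theorem mainTheorem2 {n : ℕ} (hn : 0 < n)
    (A : Matrix (Fin n) (Fin n) ℂ) (B : Fin n → ℂ)
    (hA : SpectralMoment.IsStable A) (hAB : SpectralMoment.IsReachable A B)
    (Ψ : C(Circle, ℝ)) (hΨ : ∀ z : Circle, 0 < Ψ z)
    (hI : (1 : SpectralMoment.Herm n) ∈ Set.range (SpectralMoment.Gam A B)) :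
    (SpectralMoment.posSolutions A B Ψ).Nonempty ∧
    (∀ Λ₀ ∈ SpectralMoment.solutions A B Ψ,
      SpectralMoment.solutions A B Ψ =
        (AffineSubspace.mk' Λ₀
          (SpectralMoment.orthCompl (Set.range (SpectralMoment.Gam A B))) :
            Set (SpectralMoment.Herm n))) ∧
    SpectralMoment.posSolutions A B Ψ ⊆ SpectralMoment.solutions A B Ψ ∧
    IsOpen (Subtype.val ⁻¹' SpectralMoment.posSolutions A B Ψ :
      Set (SpectralMoment.solutions A B Ψ)) ∧
    Convex ℝ (SpectralMoment.posSolutions A B Ψ) := by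
  refine ⟨SpectralMoment.posSolutions_nonempty hn hA hAB hΨ hI,
    fun _ h => SpectralMoment.solutions_eq_mk' hA hΨ h, fun _ h => h.1, ?_,
    SpectralMoment.convex_posSolutions hA hΨ⟩
  convert SpectralMoment.isOpen_setOf_posDef.preimage continuous_subtype_val using 1
  ext X
  exact ⟨fun h => h.2, fun h => ⟨X.2, h⟩⟩
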